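/- Identify $S^3$ with the unit quaternions and let $E_1,E_2,E_3$ be its global frame with $[E_i,E_j]=-2\epsilon_{ijk}E_k$ that is orthonormal for the round unit metric, with dual coframe $\omega^1,\omega^2,\omega^3$; let $z$ be the $2\pi$-periodic coordinate on $S^1$ and $E_0=\partial_z$. Consider smooth solutions on $[0,T)$, $T>0$, of the Ricci flow $\partial_t g=-2\,\mathrm{Ric}(g)$ on $S^1\times S^3$ of the form $$g(t)=\phi(z,t)^2\,dz^2+a(z,t)^2\,\omega^1\otimes\omega^1+b(z,t)^2\,\omega^2\otimes\omega^2+c(z,t)^2\,\omega^3\otimes\omega^3,$$ where $\phi,a,b,c$ are positive, $2\pi$-periodic in $z$ and smooth on $\mathbb{R}\times[0,T)$. Let $K_{0i}$ be the sectional curvature of $g(t)$ on the plane spanned by $E_0$ and $E_i$, let $f'=\phi^{-1}\partial_z f$ be the arclength derivative, and let $\check a(t)=\min_{z\in S^1}a(z,t)$. **Lemma.** For every $\lambda<2$ and every $M$ there is a constant $C=C(\lambda,M)>0$ with the following property. Let $g(t)$, $t\in[0,T)$, be a solution as above such that at $t=0$ $$a\le b\le c,\qquad 1\le \frac{c}{a}\le\lambda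 ,$$ and such that at $t=0$ the quantities $|a'|,|b'|,|c'|$ and $a^2|K_{01}|,a^2|K_{02}|,a^2|K_{03}|$ are bounded by $M$ (for any given smooth initial metric this holds with some finite $M$). Then for all $p\in S^1\times S^3$ and all $t\in[0,T)$ $$|K_{01}(p,t)|+|K_{02}(p,t)|+|K_{03}(p,t)|\le\frac{C}{\check a(t)^2}.$$ In particular $C$ depends on the solution only through $\lambda$ and the initial metric, and not on $T$. -/

import Mathlib

open scoped ContDiff

noncomputable section

namespace BianchiIX

/-- The linear space `ℝ × ℍ`, which contains `ℝ × S³` (with `S³` the unit quaternions), the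
cover of `S¹ × S³` on which the first coordinate `z` is read modulo `2π`. -/
abbrev Ambient : Type := ℝ × Quaternion ℝ

/-- The points of `ℝ × S³`. -/
def cylinder : Set Ambient := {p | ‖p.2‖ = 1}

/-- A vector field, given on the ambient space. -/
abbrev VecField : Type := Ambient → Ambient

/-- The imaginary units `i`, `j`, `k`, indexed by `1, 2, 3` (the index `0` is not used). -/
def imUnit : Fin 4 → Quaternion ℝ
  | 0 => 0
  | 1 => ⟨0, 1, 0, 0⟩
  | 2 => ⟨0, 0, 1, 0⟩
  | 3 => ⟨0, 0, 0, 1⟩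

/-- The global frame `E₀ = ∂_z` and, for `j = 1, 2, 3`, the (right-invariant) field `E_j`, whose
value at `(z, q)` is `(0, e_j q)`, with `e_j` the imaginary unit. These fields are tangent to
`ℝ × S³`; `E₁, E₂, E₃` are orthonormal on `S³` for its round unit metric and satisfy
`[E₀, E_j] = 0` and `[E_i, E_j] = -2 ε_{ijk} E_k`. -/
def frame (α : Fin 4) : VecField := fun p =>
  if α = 0 then (1, 0) else (0, imUnit α * p.2)

/-- The coframe `ω⁰ = dz, ω¹, ω², ω³` dual to `frame`: the value `ω^α(v)` at `p`. -/
def coframe (α : Fin 4) (p v : Ambient) : ℝ :=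
  if α = 0 then v.1 else inner ℝ (imUnit α * p.2) v.2 / ‖p.2‖ ^ 2

/-- A field of bilinear forms on tangent vectors. -/
abbrev MetricField : Type := Ambient → Ambient → Ambient → ℝ

/-- The metric `φ(z)² dz² + a(z)² ω¹ ⊗ ω¹ + b(z)² ω² ⊗ ω² + c(z)² ω³ ⊗ ω³`. -/
def warpedMetric (φ a b c : ℝ → ℝ) : MetricField := fun p v w =>
  φ p.1 ^ 2 * coframe 0 p v * coframe 0 p w + a p.1 ^ 2 * coframe 1 p v * coframe 1 p w
    + b p.1 ^ 2 * coframe 2 p v * coframe 2 p w + c p.1 ^ 2 * coframe 3 p v * coframe 3 p w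

/-- The function `g(X, Y)`. -/
def pair (g : MetricField) (X Y : VecField) (p : Ambient) : ℝ := g p (X p) (Y p)

/-- The directional derivative `X f`. -/
def dirDeriv (X : VecField) (f : Ambient → ℝ) (p : Ambient) : ℝ := fderiv ℝ f p (X p)

/-- The right-hand side of the Koszul formula, which is `g(∇_X Y, Z)`. -/
def koszul (g : MetricField) (X Y Z : VecField) (p : Ambient) : ℝ :=
  (dirDeriv X (pair g Y Z) p + dirDeriv Y (pair g Z X) p - dirDeriv Z (pair g X Y) p
    - pair g X (VectorField.lieBracket ℝ Y Z) p + pair g Y (VectorField.lieBracket ℝ Z X) p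
    + pair g Z (VectorField.lieBracket ℝ X Y) p) / 2

/-- The Levi-Civita connection `∇_X Y` of a metric for which the frame is orthogonal. -/
def nabla (g : MetricField) (X Y : VecField) : VecField := fun p =>
  ∑ α, (koszul g X Y (frame α) p / pair g (frame α) (frame α) p) • frame α p

/-- The Riemann curvature `R(X, Y) Z = ∇_X ∇_Y Z - ∇_Y ∇_X Z - ∇_{[X, Y]} Z`. -/
def riem (g : MetricField) (X Y Z : VecField) : VecField := fun p =>
  nabla g X (nabla g Y Z) p - nabla g Y (nabla g X Z) p
    - nabla g (VectorField.lieBracket ℝ X Y) Z p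

/-- The Ricci curvature `Ric(X, Y)`, the trace of `V ↦ R(V, X) Y`, for a metric for which the
frame is orthogonal. -/
def ric (g : MetricField) (X Y : VecField) (p : Ambient) : ℝ :=
  ∑ α, pair g (riem g (frame α) X Y) (frame α) p / pair g (frame α) (frame α) p

/-- The sectional curvature of the plane spanned by `X` and `Y`. -/
def sectional (g : MetricField) (X Y : VecField) (p : Ambient) : ℝ :=
  pair g (riem g X Y Y) X p
    / (pair g X X p * pair g Y Y p - pair g X Y p ^ 2)

/-- The sectional curvature `K_{αβ}` of the plane spanned by `E_α` and `E_β`. -/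
def K (g : MetricField) (α β : Fin 4) (p : Ambient) : ℝ := sectional g (frame α) (frame β) p

/-- The derivative `f' = φ⁻¹ ∂_z f` with respect to the arclength `ds = φ dz`. -/
def arcDeriv (φ f : ℝ → ℝ) (z : ℝ) : ℝ := deriv f z / φ z

/-- The metric at time `t` of the family given by `φ, a, b, c`, functions of `z` and `t`. -/
def metricAt (φ a b c : ℝ → ℝ → ℝ) (t : ℝ) : MetricField :=
  warpedMetric (fun z => φ z t) (fun z => a z t) (fun z => b z t) (fun z => c z t)

/-- One of the functions of `z` and `t` from which a smooth family of metrics on `S¹ × S³`, for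
`t ∈ [0, T)`, is made: positive, `2π`-periodic in `z`, and smooth up to the initial time. -/
structure IsWarpingFunction (T : ℝ) (f : ℝ → ℝ → ℝ) : Prop where
  pos : ∀ z, ∀ t ∈ Set.Ico 0 T, 0 < f z t
  periodic : ∀ t ∈ Set.Ico 0 T, Function.Periodic (fun z => f z t) (2 * Real.pi)
  smooth : ContDiffOn ℝ ∞ (fun x : ℝ × ℝ => f x.1 x.2) (Set.univ ×ˢ Set.Ico 0 T)

/-- The metrics `φ² dz² + a² ω¹ ⊗ ω¹ + b² ω² ⊗ ω² + c² ω³ ⊗ ω³` are a smooth solution of the Ricci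
flow `∂_t g = -2 Ric(g)` on `S¹ × S³` for `t ∈ [0, T)`; both sides are tensors, compared on the
frame. -/
structure IsRicciFlow (T : ℝ) (φ a b c : ℝ → ℝ → ℝ) : Prop where
  phi : IsWarpingFunction T φ
  fst : IsWarpingFunction T a
  snd : IsWarpingFunction T b
  thd : IsWarpingFunction T c
  flow : ∀ t ∈ Set.Ico 0 T, ∀ p ∈ cylinder, ∀ α β : Fin 4,
    HasDerivWithinAt (fun τ => pair (metricAt φ a b c τ) (frame α) (frame β) p)
      (-2 * ric (metricAt φ a b c t) (frame α) (frame β) p) (Set.Ico 0 T) t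

/-- The minimum `ǎ(t)` over the circle of `a(·, t)`; for a positive continuous periodic function the
infimum is attained. -/
def minOverCircle (a : ℝ → ℝ → ℝ) (t : ℝ) : ℝ := ⨅ z, a z t

/-- The initial size of the solution is at most `M`: the first arclength derivatives of `a, b, c`
and the scale-invariant curvatures `a² K₀₁, a² K₀₂, a² K₀₃` are at most `M` in absolute value at
time `0`. -/
structure InitialBound (M : ℝ) (φ a b c : ℝ → ℝ → ℝ) : Prop where
  fst : ∀ z, |arcDeriv (fun z => φ z 0) (fun z => a z 0) z| ≤ M
  snd : ∀ z, |arcDeriv (fun z => φ z 0) (fun z => b z 0) z| ≤ M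
  thd : ∀ z, |arcDeriv (fun z => φ z 0) (fun z => c z 0) z| ≤ M
  curv : ∀ p ∈ cylinder, ∀ i : Fin 3, a p.1 0 ^ 2 * |K (metricAt φ a b c 0) 0 i.succ p| ≤ M

end BianchiIX

end

/-! Write x_1, x_2, x_3 for a, b, c, and let l_i and m_i be the first and second arclength
derivatives of y_i = log x_i. Then K_{0i} = -(m_i + l_i²), and the Ricci flow becomes the system
`LogFlow` for φ and the y_i, in which the geometry of the fibre enters only through P_i = x_i / (x_j
x_k). The theorem reduces to a bound on x_i² |m_i + l_i²| that is uniform in time, and this comes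
from three applications of one maximum principle for finitely many functions,
`neg_of_deriv_neg_at_first_zero`.

Ratios (`sub_le`): where a difference y_i - y_j is the largest of all, x_i is the largest and x_j
the smallest radius, and the fibre Ricci term is larger in direction i, so the flow shrinks the
ratio. Hence the three radii stay comparable.

Gradients (`abs_gradient_lt`): with comparable radii, the reaction term for x_i' = x_i l_i is
negative as soon as |x_i'| reaches a large constant G and is the maximum.

Curvatures (`curvature_lt`): this is a Bernstein argument for x_i² (±m_i + l_i²). The diffusion of
l_i² contributes -2 m_i², quadratic in the quantity estimated, while all other terms are at most
linear in it once ratios and gradients are bounded.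

All three quantities are scale invariant and none of the constants involves T. Comparability of the
x_i finally lets the minimum of a replace x_i. -/

noncomputable section

namespace BianchiIX

/-! ### Frame fields, and the curvature of metrics diagonal in the frame. -/

/-- The imaginary quaternion with components `v 1`, `v 2`, `v 3`. -/
def imPart (v : Fin 4 → ℝ) : Quaternion ℝ := v 1 • imUnit 1 + v 2 • imUnit 2 + v 3 • imUnit 3

@[simp] lemma imPart_re (v : Fin 4 → ℝ) : (imPart v).re = 0 := by
  simp only [imPart, Quaternion.re_add, Quaternion.re_smul]
  simp [imUnit]

@[simp] lemma imPart_imI (v : Fin 4 → ℝ) : (imPart v).imI = v 1 := by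
  simp only [imPart, Quaternion.imI_add, Quaternion.imI_smul]
  simp [imUnit]

@[simp] lemma imPart_imJ (v : Fin 4 → ℝ) : (imPart v).imJ = v 2 := by
  simp only [imPart, Quaternion.imJ_add, Quaternion.imJ_smul]
  simp [imUnit]

@[simp] lemma imPart_imK (v : Fin 4 → ℝ) : (imPart v).imK = v 3 := by
  simp only [imPart, Quaternion.imK_add, Quaternion.imK_smul]
  simp [imUnit]

/-- The vector field `∑ f_α(z) E_α`. -/
def comb (f : Fin 4 → ℝ → ℝ) : VecField := fun p => (f 0 p.1, imPart (fun i => f i p.1) * p.2)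

/-- The metric `∑ h_α(z) ω^α ⊗ ω^α`. -/
def diagMetric (h : Fin 4 → ℝ → ℝ) : MetricField := fun p v w =>
  ∑ α, h α p.1 * coframe α p v * coframe α p w

lemma warpedMetric_eq_diagMetric (φ a b c : ℝ → ℝ) :
    warpedMetric φ a b c = diagMetric ![fun z => φ z ^ 2, fun z => a z ^ 2, fun z => b z ^ 2,
      fun z => c z ^ 2] := by
  funext p v w
  simp [warpedMetric, diagMetric, Fin.sum_univ_four]

/-- The constant coefficients of the frame field `E_α`. -/
def basisCoeff (α : Fin 4) : Fin 4 → ℝ → ℝ := fun β _ => if β = α then 1 else 0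

lemma frame_eq_comb (α : Fin 4) : frame α = comb (basisCoeff α) := by
  funext p
  fin_cases α <;> simp [frame, comb, basisCoeff, imPart]

lemma coframe_comb (f : Fin 4 → ℝ → ℝ) (α : Fin 4) {p : Ambient} (hp : p.2 ≠ 0) :
    coframe α p (comb f p) = f α p.1 := by
  have h : ∀ u v : Quaternion ℝ, inner ℝ (u * p.2) (v * p.2) = inner ℝ u v * ‖p.2‖ ^ 2 := by
    intro u v
    rw [Quaternion.inner_def, Quaternion.inner_def, star_mul,
      show u * p.2 * (star p.2 * star v) = u * (p.2 * star p.2) * star v by noncomm_ring,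
      Quaternion.self_mul_star, Quaternion.normSq_eq_norm_mul_self, ← pow_two,
      ← Quaternion.coe_commutes, mul_assoc, Quaternion.coe_mul_eq_smul, Quaternion.re_smul,
      smul_eq_mul, mul_comm]
  have h0 : ‖p.2‖ ^ 2 ≠ 0 := by positivity
  fin_cases α
  · simp [coframe, comb]
  all_goals
    simp only [coframe, comb]
    rw [if_neg (by decide), h, mul_div_assoc, div_self h0, mul_one, Quaternion.inner_def]
    simp only [Quaternion.re_mul, Quaternion.re_star, Quaternion.imI_star, Quaternion.imJ_star,
      Quaternion.imK_star, imPart_re, imPart_imI, imPart_imJ, imPart_imK]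
    simp [imUnit]

lemma pair_comb (h f k : Fin 4 → ℝ → ℝ) {p : Ambient} (hp : p.2 ≠ 0) :
    pair (diagMetric h) (comb f) (comb k) p = ∑ α, h α p.1 * f α p.1 * k α p.1 := by
  simp only [pair, diagMetric, coframe_comb _ _ hp]

lemma eventually_snd_ne {p : Ambient} (hp : p.2 ≠ 0) : ∀ᶠ q : Ambient in nhds p, q.2 ≠ 0 :=
  continuous_snd.continuousAt.eventually_ne hp

lemma hasFDerivAt_comp_fst {F : ℝ → ℝ} {F' : ℝ} {p : Ambient} (hF : HasDerivAt F F' p.1) :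
    HasFDerivAt (fun q : Ambient => F q.1) (F' • ContinuousLinearMap.fst ℝ ℝ (Quaternion ℝ)) p :=
  hF.comp_hasFDerivAt p hasFDerivAt_fst

lemma dirDeriv_comb (f : Fin 4 → ℝ → ℝ) {F : ℝ → ℝ} {F' : ℝ} {u : Ambient → ℝ} {p : Ambient}
    (hu : u =ᶠ[nhds p] fun q => F q.1) (hF : HasDerivAt F F' p.1) :
    dirDeriv (comb f) u p = f 0 p.1 * F' := by
  rw [dirDeriv, hu.fderiv_eq, (hasFDerivAt_comp_fst hF).fderiv]
  simp [comb, mul_comm]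

lemma fderiv_comb {f f' : Fin 4 → ℝ → ℝ} {p : Ambient}
    (hf : ∀ i, HasDerivAt (f i) (f' i p.1) p.1) (w : Ambient) :
    fderiv ℝ (comb f) p w = (w.1 * f' 0 p.1,
      w.1 • (imPart (fun i => f' i p.1) * p.2) + imPart (fun i => f i p.1) * w.2) := by
  have h1 : ∀ i, HasFDerivAt (fun q : Ambient => f i q.1 • imUnit i) _ p := fun i =>
    (hasFDerivAt_comp_fst (hf i)).smul_const (imUnit i)
  have h2 : HasFDerivAt (fun q : Ambient => imPart (fun i => f i q.1)) _ p :=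
    ((h1 1).add (h1 2)).add (h1 3)
  have h3 := (hasFDerivAt_comp_fst (hf 0)).prodMk (h2.mul' (hasFDerivAt_snd (p := p)))
  have h4 : fderiv ℝ (comb f) p = _ := HasFDerivAt.fderiv h3
  rw [h4]
  ext1
  · simp [mul_comm]
  · simp [imPart, mul_smul, smul_add, add_mul]
    simp [smul_smul, mul_comm]
    abel

/-- The fields q ↦ uq and q ↦ vq have bracket (vu - uv)q, which accounts for the structure constants
-2ε. The coefficients vary only with z, so they are differentiated only by the 0-components. -/
lemma lieBracket_comb {f f' k k' : Fin 4 → ℝ → ℝ} {p : Ambient}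
    (hf : ∀ i, HasDerivAt (f i) (f' i p.1) p.1) (hk : ∀ i, HasDerivAt (k i) (k' i p.1) p.1) :
    VectorField.lieBracket ℝ (comb f) (comb k) p =
      comb ![fun z => f 0 z * k' 0 z - k 0 z * f' 0 z,
        fun z => f 0 z * k' 1 z - k 0 z * f' 1 z - 2 * (f 2 z * k 3 z - f 3 z * k 2 z),
        fun z => f 0 z * k' 2 z - k 0 z * f' 2 z - 2 * (f 3 z * k 1 z - f 1 z * k 3 z),
        fun z => f 0 z * k' 3 z - k 0 z * f' 3 z - 2 * (f 1 z * k 2 z - f 2 z * k 1 z)] p := by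
  rw [VectorField.lieBracket_eq]
  simp only [fderiv_comb hf, fderiv_comb hk]
  ext1
  · simp [comb]
  · have : ∀ u v : Quaternion ℝ, u * (v * p.2) = (u * v) * p.2 := fun u v => by rw [mul_assoc]
    simp only [comb, Prod.snd_sub, this, ← smul_mul_assoc, ← add_mul, ← sub_mul]
    congr 1
    ext <;> simp <;> ring

/-- The coefficients of `∇_V W` for constant combinations `V = ∑ v_α E_α`, `W = ∑ k_α E_α`, where
`h_α` are the coefficients of the metric and `q_α` their half logarithmic derivatives. -/
def christ (h q : Fin 4 → ℝ → ℝ) (v k : Fin 4 → ℝ) (δ : Fin 4) (z : ℝ) : ℝ :=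
  ![v 0 * k 0 * q 0 z - v 1 * k 1 * (q 1 z * h 1 z / h 0 z) - v 2 * k 2 * (q 2 z * h 2 z / h 0 z)
      - v 3 * k 3 * (q 3 z * h 3 z / h 0 z),
    (v 0 * k 1 + v 1 * k 0) * q 1 z - v 2 * k 3 * (1 + h 3 z / h 1 z - h 2 z / h 1 z)
      + v 3 * k 2 * (1 + h 2 z / h 1 z - h 3 z / h 1 z),
    (v 0 * k 2 + v 2 * k 0) * q 2 z - v 3 * k 1 * (1 + h 1 z / h 2 z - h 3 z / h 2 z)
      + v 1 * k 3 * (1 + h 3 z / h 2 z - h 1 z / h 2 z),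
    (v 0 * k 3 + v 3 * k 0) * q 3 z - v 1 * k 2 * (1 + h 2 z / h 3 z - h 1 z / h 3 z)
      + v 2 * k 1 * (1 + h 1 z / h 3 z - h 2 z / h 3 z)] δ

/-- The derivative of `christ` in `z`, where `q'` is the derivative of `q`. -/
def christDeriv (h q q' : Fin 4 → ℝ → ℝ) (v k : Fin 4 → ℝ) (δ : Fin 4) (z : ℝ) : ℝ :=
  let r : Fin 4 → Fin 4 → ℝ := fun i j => 2 * (q i z - q j z) * (h i z / h j z)
  let s : Fin 4 → ℝ := fun i => (q' i z + 2 * q i z * (q i z - q 0 z)) * (h i z / h 0 z)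
  ![v 0 * k 0 * q' 0 z - v 1 * k 1 * s 1 - v 2 * k 2 * s 2 - v 3 * k 3 * s 3,
    (v 0 * k 1 + v 1 * k 0) * q' 1 z - v 2 * k 3 * (r 3 1 - r 2 1) + v 3 * k 2 * (r 2 1 - r 3 1),
    (v 0 * k 2 + v 2 * k 0) * q' 2 z - v 3 * k 1 * (r 1 2 - r 3 2) + v 1 * k 3 * (r 3 2 - r 1 2),
    (v 0 * k 3 + v 3 * k 0) * q' 3 z - v 1 * k 2 * (r 2 3 - r 1 3) + v 2 * k 1 * (r 1 3 - r 2 3)] δ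

section
variable {h q q' : Fin 4 → ℝ → ℝ} (hpos : ∀ i z, 0 < h i z)
  (hh : ∀ i z, HasDerivAt (h i) (2 * q i z * h i z) z)
  (hq : ∀ i z, HasDerivAt (q i) (q' i z) z)
include hpos hh

/-- The second field needs coefficients depending on z because an iterated covariant derivative
applies the connection to `christ`; constant coefficients suffice for the first. -/
lemma nabla_comb {v : Fin 4 → ℝ} {k k' : Fin 4 → ℝ → ℝ} (hk : ∀ i z, HasDerivAt (k i) (k' i z) z)
    {p : Ambient} (hp : p.2 ≠ 0) :
    nabla (diagMetric h) (comb fun i _ => v i) (comb k) p =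
      comb (fun δ z => v 0 * k' δ z + christ h q v (fun i => k i z) δ z) p := by
  have hv : ∀ i z, HasDerivAt ((fun (i : Fin 4) (_ : ℝ) => v i) i)
    ((fun (_ : Fin 4) (_ : ℝ) => (0 : ℝ)) i z) z := fun i z => hasDerivAt_const z (v i)
  have key : ∀ δ, koszul (diagMetric h) (comb fun i _ => v i) (comb k) (frame δ) p =
      h δ p.1 * (v 0 * k' δ p.1 + christ h q v (fun i => k i p.1) δ p.1) := by
    intro δ
    have hu : ∀ i z, HasDerivAt (basisCoeff δ i)
      ((fun (_ : Fin 4) (_ : ℝ) => (0 : ℝ)) i z) z := fun i z => hasDerivAt_const z _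
    have hd : ∀ {f f' g g' : Fin 4 → ℝ → ℝ}, (∀ i z, HasDerivAt (f i) (f' i z) z) →
        (∀ i z, HasDerivAt (g i) (g' i z) z) → ∀ z, HasDerivAt
        (fun z => ∑ α, h α z * f α z * g α z) (∑ α, ((2 * q α z * h α z * f α z
          + h α z * f' α z) * g α z + h α z * f α z * g' α z)) z := by
      intro f f' g g' hf hg z
      refine HasDerivAt.fun_sum fun α _ => ?_
      exact ((hh α z).mul (hf α z)).mul (hg α z)
    have he : ∀ f g : Fin 4 → ℝ → ℝ, pair (diagMetric h) (comb f) (comb g) =ᶠ[nhds p]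
        fun p => (fun z => ∑ α, h α z * f α z * g α z) p.1 := fun f g => by
      filter_upwards [eventually_snd_ne hp] with x hx
      exact pair_comb h f g hx
    have hb : ∀ (f g : Fin 4 → ℝ → ℝ) (X : VecField), X p = comb g p →
        pair (diagMetric h) (comb f) X p = ∑ α, h α p.1 * f α p.1 * g α p.1 := by
      intro f g X hX
      rw [← pair_comb h f g hp, pair, pair, hX]
    rw [frame_eq_comb, koszul, dirDeriv_comb _ (he _ _) (hd hk hu _),
      dirDeriv_comb _ (he _ _) (hd hu hv _), dirDeriv_comb _ (he _ _) (hd hv hk _),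
      hb _ _ _ (lieBracket_comb (f' := k') (k' := fun _ _ => 0) (fun i => hk i _) (fun i => hu i _)),
      hb _ _ _ (lieBracket_comb (f' := fun _ _ => 0) (k' := fun _ _ => 0) (fun i => hu i _)
        (fun i => hv i _)),
      hb _ _ _ (lieBracket_comb (f' := fun _ _ => 0) (k' := k') (fun i => hv i _) (fun i => hk i _))]
    have h0 := (hpos 0 p.1).ne'
    have h1 := (hpos 1 p.1).ne'
    have h2 := (hpos 2 p.1).ne'
    have h3 := (hpos 3 p.1).ne'
    fin_cases δ <;> simp [Fin.sum_univ_four, basisCoeff, christ] <;> field_simp <;> ring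
  have hpair : ∀ δ, pair (diagMetric h) (frame δ) (frame δ) p = h δ p.1 := by
    intro δ
    rw [frame_eq_comb, pair_comb h _ _ hp]
    simp [basisCoeff]
  simp only [nabla, key, hpair, mul_div_cancel_left₀ _ (hpos _ _).ne']
  rw [Fin.sum_univ_four]
  ext1
  · simp [frame, comb]
  · simp [frame, comb, imPart, add_mul]

include hq

lemma hasDerivAt_christ (v k : Fin 4 → ℝ) (δ : Fin 4) (z : ℝ) :
    HasDerivAt (christ h q v k δ) (christDeriv h q q' v k δ z) z := by
  have hr : ∀ i j, HasDerivAt (fun z => h i z / h j z)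
      (2 * (q i z - q j z) * (h i z / h j z)) z := by
    intro i j
    have hj := (hpos j z).ne'
    refine ((hh i z).fun_div (hh j z) hj).congr_deriv ?_
    field_simp
  have hs : ∀ i, HasDerivAt (fun z => q i z * h i z / h 0 z)
      ((q' i z + 2 * q i z * (q i z - q 0 z)) * (h i z / h 0 z)) z := by
    intro i
    have hj := (hpos 0 z).ne'
    refine (((hq i z).fun_mul (hh i z)).fun_div (hh 0 z) hj).congr_deriv ?_
    field_simp
    ring
  have hc : ∀ i j k : Fin 4, HasDerivAt (fun z => 1 + h i z / h k z - h j z / h k z)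
      (2 * (q i z - q k z) * (h i z / h k z) - 2 * (q j z - q k z) * (h j z / h k z)) z :=
    fun i j k => ((hr i k).const_add 1).sub (hr j k)
  fin_cases δ
  · exact ((((hq 0 z).const_mul _).sub ((hs 1).const_mul _)).sub ((hs 2).const_mul _)).sub
      ((hs 3).const_mul _)
  · exact (((hq 1 z).const_mul _).sub ((hc 3 2 1).const_mul _)).add ((hc 2 3 1).const_mul _)
  · exact (((hq 2 z).const_mul _).sub ((hc 1 3 2).const_mul _)).add ((hc 3 1 2).const_mul _)
  · exact (((hq 3 z).const_mul _).sub ((hc 2 1 3).const_mul _)).add ((hc 1 2 3).const_mul _)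

lemma riem_comb (v w u : Fin 4 → ℝ) {p : Ambient} (hp : p.2 ≠ 0) :
    riem (diagMetric h) (comb fun i _ => v i) (comb fun i _ => w i) (comb fun i _ => u i) p =
      comb (fun δ z =>
        (v 0 * christDeriv h q q' w u δ z + christ h q v (fun i => christ h q w u i z) δ z)
        - (w 0 * christDeriv h q q' v u δ z + christ h q w (fun i => christ h q v u i z) δ z)
        - christ h q ![0, -2 * (v 2 * w 3 - v 3 * w 2), -2 * (v 3 * w 1 - v 1 * w 3),
          -2 * (v 1 * w 2 - v 2 * w 1)] u δ z) p := by
  have hconst : ∀ (v : Fin 4 → ℝ) i z, HasDerivAt ((fun (i : Fin 4) (_ : ℝ) => v i) i)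
    ((fun (_ : Fin 4) (_ : ℝ) => (0 : ℝ)) i z) z := fun v i z => hasDerivAt_const z (v i)
  have hn : ∀ v u : Fin 4 → ℝ,
      nabla (diagMetric h) (comb fun i _ => v i) (comb fun i _ => u i) =ᶠ[nhds p]
        comb (christ h q v u) := fun v u => by
    filter_upwards [eventually_snd_ne hp] with x hx
    rw [nabla_comb hpos hh (hconst u) hx]
    simp
  -- The Koszul formula differentiates the inner field, so its formula is needed near p and not only
  -- at p; it holds wherever the quaternion component is nonzero.
  have hcongr : ∀ X Y Y' : VecField, Y =ᶠ[nhds p] Y' →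
      nabla (diagMetric h) X Y p = nabla (diagMetric h) X Y' p := by
    intro X Y Y' hY
    have e1 : ∀ Z, pair (diagMetric h) Y Z =ᶠ[nhds p] pair (diagMetric h) Y' Z := fun Z => by
      filter_upwards [hY] with x hx
      simp only [pair, hx]
    have e2 : ∀ Z, pair (diagMetric h) Z Y =ᶠ[nhds p] pair (diagMetric h) Z Y' := fun Z => by
      filter_upwards [hY] with x hx
      simp only [pair, hx]
    have e3 : ∀ Z, VectorField.lieBracket ℝ Y Z p = VectorField.lieBracket ℝ Y' Z p := fun Z =>
      hY.lieBracket_vectorField_eq (Filter.EventuallyEq.refl _ Z)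
    have e4 : ∀ Z, VectorField.lieBracket ℝ Z Y p = VectorField.lieBracket ℝ Z Y' p := fun Z =>
      (Filter.EventuallyEq.refl _ Z).lieBracket_vectorField_eq hY
    have : ∀ Z, koszul (diagMetric h) X Y Z p = koszul (diagMetric h) X Y' Z p := by
      intro Z
      simp only [koszul, dirDeriv, (e1 Z).fderiv_eq, (e2 X).fderiv_eq, hY.eq_of_nhds]
      simp only [pair, e3, e4, hY.eq_of_nhds]
    simp only [nabla, this]
  have hbr : VectorField.lieBracket ℝ (comb fun i _ => v i) (comb fun i _ => w i) =
      comb fun i _ => ![0, -2 * (v 2 * w 3 - v 3 * w 2), -2 * (v 3 * w 1 - v 1 * w 3),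
          -2 * (v 1 * w 2 - v 2 * w 1)] i := by
    funext x
    rw [lieBracket_comb (f' := fun _ _ => 0) (k' := fun _ _ => 0) (fun i => hconst v i _)
      (fun i => hconst w i _)]
    congr 1
    funext i z
    fin_cases i <;> simp
  rw [riem, hcongr _ _ _ (hn w u), hcongr _ _ _ (hn v u), hbr, (hn _ u).eq_of_nhds,
    nabla_comb hpos hh (hasDerivAt_christ hpos hh hq w u) hp,
    nabla_comb hpos hh (hasDerivAt_christ hpos hh hq v u) hp]
  ext1
  · simp [comb]
  · simp only [comb, Prod.snd_sub, ← sub_mul]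
    congr 1
    ext <;> simp

end

section
variable {h q q' : Fin 4 → ℝ → ℝ} (hpos : ∀ i z, 0 < h i z)
  (hh : ∀ i z, HasDerivAt (h i) (2 * q i z * h i z) z)
  (hq : ∀ i z, HasDerivAt (q i) (q' i z) z)
include hpos hh hq

lemma pair_riem_frame (α β γ δ : Fin 4) {p : Ambient} (hp : p.2 ≠ 0) :
    pair (diagMetric h) (riem (diagMetric h) (frame α) (frame β) (frame γ)) (frame δ) p =
      h δ p.1 *
        ((basisCoeff α 0 0 * christDeriv h q q' (basisCoeff β · 0) (basisCoeff γ · 0) δ p.1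
          + christ h q (basisCoeff α · 0)
            (fun i => christ h q (basisCoeff β · 0) (basisCoeff γ · 0) i p.1) δ p.1)
        - (basisCoeff β 0 0 * christDeriv h q q' (basisCoeff α · 0) (basisCoeff γ · 0) δ p.1
          + christ h q (basisCoeff β · 0)
            (fun i => christ h q (basisCoeff α · 0) (basisCoeff γ · 0) i p.1) δ p.1)
        - christ h q ![0, -2 * (basisCoeff α 2 0 * basisCoeff β 3 0
            - basisCoeff α 3 0 * basisCoeff β 2 0),
          -2 * (basisCoeff α 3 0 * basisCoeff β 1 0 - basisCoeff α 1 0 * basisCoeff β 3 0),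
          -2 * (basisCoeff α 1 0 * basisCoeff β 2 0 - basisCoeff α 2 0 * basisCoeff β 1 0)]
          (basisCoeff γ · 0) δ p.1) := by
  have e : ∀ X Y Z W : VecField, ∀ f k : Fin 4 → ℝ → ℝ,
      riem (diagMetric h) X Y Z p = comb f p → W = comb k →
      pair (diagMetric h) (riem (diagMetric h) X Y Z) W p = ∑ α, h α p.1 * f α p.1 * k α p.1 := by
    intro X Y Z W f k h1 h2
    rw [← pair_comb h f k hp, pair, pair, h1, h2]
  have hr := riem_comb hpos hh hq (basisCoeff α · 0) (basisCoeff β · 0) (basisCoeff γ · 0) hp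
  rw [e (frame α) (frame β) (frame γ) (frame δ) _ (basisCoeff δ)
    (by rw [frame_eq_comb, frame_eq_comb, frame_eq_comb]; exact hr) (frame_eq_comb δ)]
  rw [Finset.sum_eq_single δ]
  · simp [basisCoeff]
  · intro b _ hb
    simp [basisCoeff, hb]
  · simp

/-- With h_0 = φ² and h_i = x_i², the right-hand side is -x_i''/x_i for arclength derivatives; the
term with q_0 comes from the factor 1/φ in them. -/
lemma K_zero_succ (i : Fin 3) {p : Ambient} (hp : p.2 ≠ 0) :
    K (diagMetric h) 0 i.succ p =
      -(q' i.succ p.1 - q 0 p.1 * q i.succ p.1 + q i.succ p.1 ^ 2) / h 0 p.1 := by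
  have h0 := (hpos 0 p.1).ne'
  have h1 := (hpos 1 p.1).ne'
  have h2 := (hpos 2 p.1).ne'
  have h3 := (hpos 3 p.1).ne'
  rw [K, sectional, pair_riem_frame hpos hh hq _ _ _ _ hp, frame_eq_comb, frame_eq_comb,
    pair_comb h _ _ hp, pair_comb h _ _ hp, pair_comb h _ _ hp]
  fin_cases i <;>
  · simp [basisCoeff, christ, christDeriv]
    field_simp
    ring

lemma ric_zero {p : Ambient} (hp : p.2 ≠ 0) :
    ric (diagMetric h) (frame 0) (frame 0) p =
      -∑ i : Fin 3, (q' i.succ p.1 - q 0 p.1 * q i.succ p.1 + q i.succ p.1 ^ 2) := by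
  have h0 := (hpos 0 p.1).ne'
  have h1 := (hpos 1 p.1).ne'
  have h2 := (hpos 2 p.1).ne'
  have h3 := (hpos 3 p.1).ne'
  simp only [ric, pair_riem_frame hpos hh hq _ _ _ _ hp, Fin.sum_univ_four, Fin.sum_univ_three]
  simp only [frame_eq_comb, pair_comb h _ _ hp]
  simp [basisCoeff, christ, christDeriv]
  field_simp
  ring

lemma ric_succ (i : Fin 3) {p : Ambient} (hp : p.2 ≠ 0) :
    ric (diagMetric h) (frame i.succ) (frame i.succ) p = h i.succ p.1 *
      (-(q' i.succ p.1 - q 0 p.1 * q i.succ p.1) / h 0 p.1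
        - q i.succ p.1 * (∑ j : Fin 3, q j.succ p.1) / h 0 p.1
        + 2 * (h i.succ p.1 ^ 2 - (h (i + 1).succ p.1 - h (i + 2).succ p.1) ^ 2)
          / (h 1 p.1 * h 2 p.1 * h 3 p.1)) := by
  have h0 := (hpos 0 p.1).ne'
  have h1 := (hpos 1 p.1).ne'
  have h2 := (hpos 2 p.1).ne'
  have h3 := (hpos 3 p.1).ne'
  simp only [ric, pair_riem_frame hpos hh hq _ _ _ _ hp, Fin.sum_univ_four, Fin.sum_univ_three]
  simp only [frame_eq_comb, pair_comb h _ _ hp]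
  fin_cases i <;>
  · simp [basisCoeff, christ, christDeriv]
    field_simp
    ring

end

/-! ### The maximum principle. -/

section MaximumPrinciple
open Filter Topology Set

/-- A strict maximum principle for finitely many functions that are periodic in space: if all of
them are negative initially, and the time derivative of each is negative wherever it vanishes at
a time at which all of them are nonpositive, then they stay negative. -/
theorem neg_of_deriv_neg_at_first_zero {ι : Type*} [Finite ι] {T L : ℝ} (hL : 0 < L)
    {u : ι → ℝ → ℝ → ℝ}
    (hc : ∀ i, ContinuousOn (fun x : ℝ × ℝ => u i x.1 x.2) (univ ×ˢ Ico 0 T))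
    (hper : ∀ i, ∀ t ∈ Ico 0 T, Function.Periodic (fun z => u i z t) L)
    (h0 : ∀ i z, u i z 0 < 0)
    (hstep : ∀ i z₀, ∀ t₀ ∈ Ioo 0 T, (∀ j z, u j z t₀ ≤ 0) → u i z₀ t₀ = 0 →
      ∃ d < 0, HasDerivAt (fun t => u i z₀ t) d t₀) :
    ∀ i, ∀ t ∈ Ico 0 T, ∀ z, u i z t < 0 := by
  by_contra! hcon
  obtain ⟨i₁, t₁, ht₁, z₁, hz₁⟩ := hcon
  have hsub : Icc (0 : ℝ) L ×ˢ Icc 0 t₁ ⊆ univ ×ˢ Ico 0 T :=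
    prod_mono (subset_univ _) fun t ht => ⟨ht.1, ht.2.trans_lt ht₁.2⟩
  have hred : ∀ i, ∀ t ∈ Ico 0 T, ∀ z, ∃ z' ∈ Icc (0 : ℝ) L, u i z' t = u i z t := by
    intro i t ht z
    obtain ⟨y, hy, hyz⟩ := (hper i t ht).exists_mem_Ico₀ hL z
    exact ⟨y, Ico_subset_Icc_self hy, hyz.symm⟩
  let B : Set ℝ := ⋃ i, Prod.snd '' ((Icc (0 : ℝ) L ×ˢ Icc 0 t₁) ∩
    (fun x : ℝ × ℝ => u i x.1 x.2) ⁻¹' Ici 0)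
  have hBmem : ∀ t, t ∈ B ↔ t ∈ Icc 0 t₁ ∧ ∃ i, ∃ z ∈ Icc (0 : ℝ) L, 0 ≤ u i z t := by
    intro t
    simp only [B, mem_iUnion, mem_image, mem_inter_iff, mem_prod, mem_preimage, mem_Ici,
      Prod.exists]
    constructor
    · rintro ⟨i, z, s, ⟨⟨hz, hs⟩, h⟩, rfl⟩
      exact ⟨hs, i, z, hz, h⟩
    · rintro ⟨hs, i, z, hz, h⟩
      exact ⟨i, z, t, ⟨⟨hz, hs⟩, h⟩, rfl⟩
  have hB : IsCompact B := by
    refine isCompact_iUnion fun i => IsCompact.image ?_ continuous_snd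
    have hK : IsCompact (Icc (0 : ℝ) L ×ˢ Icc 0 t₁) := isCompact_Icc.prod isCompact_Icc
    exact hK.of_isClosed_subset
      (((hc i).mono hsub).preimage_isClosed_of_isClosed hK.isClosed isClosed_Ici) inter_subset_left
  have hne : B.Nonempty := by
    obtain ⟨z, hz, h⟩ := hred i₁ t₁ ht₁ z₁
    exact ⟨t₁, (hBmem _).2 ⟨⟨ht₁.1, le_rfl⟩, i₁, z, hz, h ▸ hz₁⟩⟩
  obtain ⟨t₀, ht₀, hleast⟩ := hB.exists_isLeast hne
  obtain ⟨ht₀', i, z₀, hz₀, hu⟩ := (hBmem _).1 ht₀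
  have hpos : 0 < t₀ := by
    rcases ht₀'.1.eq_or_lt with h | h
    · rw [← h] at hu
      exact absurd (h0 i z₀) (not_lt.2 hu)
    · exact h
  have htT : t₀ < T := ht₀'.2.trans_lt ht₁.2
  have hbefore : ∀ j z, ∀ t ∈ Ico 0 t₀, u j z t < 0 := by
    intro j z t ht
    by_contra! h
    obtain ⟨z', hz', h'⟩ := hred j t ⟨ht.1, ht.2.trans htT⟩ z
    exact absurd (hleast ((hBmem t).2 ⟨⟨ht.1, ht.2.le.trans ht₀'.2⟩, j, z', hz', h' ▸ h⟩))
      (not_le.2 ht.2)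
  have hev : ∀ᶠ t in 𝓝[<] t₀, t ∈ Ico 0 t₀ := Ico_mem_nhdsLT hpos
  have hle : ∀ j z, u j z t₀ ≤ 0 := by
    intro j z
    have h1 : ContinuousWithinAt (fun t => u j z t) (Ico 0 T) t₀ := by
      have := hc j (z, t₀) ⟨mem_univ _, hpos.le, htT⟩
      exact ContinuousWithinAt.comp (f := fun t : ℝ => (z, t)) (s := Ico 0 T) this
        (by fun_prop) (fun t ht => ⟨mem_univ _, ht⟩)
    have h2 : Tendsto (fun t => u j z t) (𝓝[<] t₀) (𝓝 (u j z t₀)) :=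
      h1.tendsto.mono_left (nhdsWithin_le_of_mem
        (mem_of_superset (Ico_mem_nhdsLT hpos) (Ico_subset_Ico_right htT.le)))
    exact le_of_tendsto h2 (hev.mono fun t ht => (hbefore j z t ht).le)
  have hzero : u i z₀ t₀ = 0 := le_antisymm (hle i z₀) hu
  obtain ⟨d, hd, hder⟩ := hstep i z₀ t₀ ⟨hpos, htT⟩ hle hzero
  -- The function is negative before t₀ and zero at t₀, so its left difference quotients are
  -- nonnegative, against d < 0.
  have h3 := (hasDerivAt_iff_tendsto_slope.1 hder).mono_left
    (nhdsWithin_mono t₀ (show Iio t₀ ⊆ {t₀}ᶜ from fun x hx => ne_of_lt hx))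
  refine absurd (ge_of_tendsto h3 (hev.mono fun t ht => ?_)) (not_le.2 hd)
  rw [slope_def_field, hzero, sub_zero]
  exact div_nonneg_of_nonpos (hbefore i z₀ t ht).le (sub_nonpos.2 ht.2.le)

end MaximumPrinciple

/-- A positive second derivative would make the maximum a local minimum as well, hence f locally
constant, and the second derivative zero. -/
lemma deriv_deriv_nonpos_of_isMax {f : ℝ → ℝ} {x : ℝ} (hf : ContDiff ℝ 2 f)
    (hmax : ∀ y, f y ≤ f x) : deriv (deriv f) x ≤ 0 := by
  by_contra! h
  have hd : deriv f x = 0 := IsLocalMax.deriv_eq_zero (Filter.Eventually.of_forall hmax)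
  have hmin := isLocalMin_of_deriv_deriv_pos h hd hf.continuous.continuousAt
  have hconst : f =ᶠ[nhds x] fun _ => f x := by
    filter_upwards [hmin] with y hy
    exact le_antisymm (hmax y) hy
  have h2 : deriv f =ᶠ[nhds x] fun _ => 0 := by
    simpa using hconst.deriv
  rw [h2.deriv_eq] at h
  simp at h

/-! ### Arclength derivatives of functions of space and time. -/

/-- Smoothness of a function of `z` and `t` on `ℝ × [0, T)`. -/
def SmoothUpTo (T : ℝ) (f : ℝ → ℝ → ℝ) : Prop :=
  ContDiffOn ℝ ∞ (fun x : ℝ × ℝ => f x.1 x.2) (Set.univ ×ˢ Set.Ico 0 T)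

/-- The derivative `φ⁻¹ ∂_z f` for functions of `z` and `t`. -/
def arcD (φ f : ℝ → ℝ → ℝ) (z t : ℝ) : ℝ := deriv (fun x => f x t) z / φ z t

section
variable {T : ℝ} {f g φ R : ℝ → ℝ → ℝ}

lemma SmoothUpTo.contDiff (hf : SmoothUpTo T f) {t : ℝ} (ht : t ∈ Set.Ico 0 T) :
    ContDiff ℝ ∞ (fun z => f z t) := by
  rw [← contDiffOn_univ]
  exact ContDiffOn.comp (g := fun x : ℝ × ℝ => f x.1 x.2) (f := fun z : ℝ => (z, t)) hf
    (by fun_prop) (fun z _ => ⟨Set.mem_univ _, ht⟩)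

/-- Horizontal lines stay in the domain, so the z-derivative is the derivative within the domain
applied to (1, 0), also on the boundary t = 0. -/
lemma SmoothUpTo.deriv_fst (hf : SmoothUpTo T f) :
    SmoothUpTo T (fun z t => deriv (fun x => f x t) z) := by
  have hS : UniqueDiffOn ℝ ((Set.univ : Set ℝ) ×ˢ Set.Ico 0 T) :=
    uniqueDiffOn_univ.prod (uniqueDiffOn_Ico 0 T)
  have h1 : ContDiffOn ℝ ∞ (fun x => fderivWithin ℝ (fun x : ℝ × ℝ => f x.1 x.2)
      (Set.univ ×ˢ Set.Ico 0 T) x (1, 0)) (Set.univ ×ˢ Set.Ico 0 T) :=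
    (hf.fderivWithin hS (m := ∞) (by simp)).clm_apply contDiffOn_const
  refine h1.congr fun x hx => ?_
  have h2 := (hf.differentiableOn (by simp) x hx).hasFDerivWithinAt
  have h3 : HasDerivAt (fun z : ℝ => (z, x.2)) ((1 : ℝ), (0 : ℝ)) x.1 :=
    (hasDerivAt_id x.1).prodMk (hasDerivAt_const _ _)
  have h4 := (h2.comp_hasDerivWithinAt (s := Set.univ) (t := Set.univ ×ˢ Set.Ico 0 T) (f := fun z : ℝ => (z, x.2)) x.1
    h3.hasDerivWithinAt (fun z _ => ⟨Set.mem_univ _, hx.2⟩)).hasDerivAt Filter.univ_mem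
  exact h4.deriv

lemma SmoothUpTo.arcD (hφ : SmoothUpTo T φ) (hpos : ∀ z, ∀ t ∈ Set.Ico 0 T, 0 < φ z t)
    (hf : SmoothUpTo T f) : SmoothUpTo T (arcD φ f) :=
  ContDiffOn.div hf.deriv_fst hφ fun x hx => (hpos x.1 x.2 hx.2).ne'

lemma SmoothUpTo.hasDerivAt (hf : SmoothUpTo T f) {z t : ℝ} (ht : t ∈ Set.Ico 0 T)
    (hpos : 0 < φ z t) : HasDerivAt (fun x => f x t) (φ z t * BianchiIX.arcD φ f z t) z := by
  have h := ((hf.contDiff ht).differentiable (by simp) z).hasDerivAt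
  rwa [BianchiIX.arcD, mul_div_cancel₀ _ hpos.ne']

lemma arcD_eq_of_hasDerivAt {d z t : ℝ} (hpos : 0 < φ z t)
    (h : HasDerivAt (fun x => f x t) (φ z t * d) z) : arcD φ f z t = d := by
  rw [arcD, h.deriv, mul_div_cancel_left₀ _ hpos.ne']

lemma arcD_periodic {L : ℝ} {t : ℝ} (hφ : Function.Periodic (fun z => φ z t) L)
    (hf : Function.Periodic (fun z => f z t) L) : Function.Periodic (fun z => arcD φ f z t) L := by
  intro z
  have h1 : deriv (fun x => f x t) (z + L) = deriv (fun x => f x t) z := by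
    rw [← deriv_comp_add_const]
    congr 1
    funext x
    exact hf x
  have h2 : φ (z + L) t = φ z t := hφ z
  simp only [arcD, h1, h2]

lemma hasDerivAt_deriv_fst (hf : SmoothUpTo T f)
    (hg : ∀ z, ∀ t ∈ Set.Ioo 0 T, HasDerivAt (fun τ => f z τ) (g z t) t) (z : ℝ) {t : ℝ}
    (ht : t ∈ Set.Ioo 0 T) :
    HasDerivAt (fun τ => deriv (fun x => f x τ) z) (deriv (fun x => g x t) z) t := by
  set F : ℝ × ℝ → ℝ := fun x => f x.1 x.2 with hF
  have hat : ∀ x : ℝ × ℝ, x.2 ∈ Set.Ioo 0 T → ContDiffAt ℝ ∞ F x := fun x hx =>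
    hf.contDiffAt (prod_mem_nhds Filter.univ_mem (Ico_mem_nhds hx.1 hx.2))
  have hd : ∀ x : ℝ × ℝ, x.2 ∈ Set.Ioo 0 T → HasFDerivAt F (fderiv ℝ F x) x := fun x hx =>
    ((hat x hx).differentiableAt (by simp)).hasFDerivAt
  have hz : ∀ z t : ℝ, HasDerivAt (fun x : ℝ => (x, t)) ((1 : ℝ), (0 : ℝ)) z := fun z t =>
    (hasDerivAt_id z).prodMk (hasDerivAt_const _ _)
  have hτ : ∀ z t : ℝ, HasDerivAt (fun τ : ℝ => (z, τ)) ((0 : ℝ), (1 : ℝ)) t := fun z t =>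
    (hasDerivAt_const _ _).prodMk (hasDerivAt_id t)
  have e1 : ∀ z, ∀ t ∈ Set.Ioo 0 T, deriv (fun x => f x t) z = fderiv ℝ F (z, t) (1, 0) :=
    fun z t ht => ((hd (z, t) ht).comp_hasDerivAt (f := fun x : ℝ => (x, t)) z (hz z t)).deriv
  have e2 : ∀ z, ∀ t ∈ Set.Ioo 0 T, g z t = fderiv ℝ F (z, t) (0, 1) :=
    fun z t ht => (hg z t ht).unique
      ((hd (z, t) ht).comp_hasDerivAt (f := fun τ : ℝ => (z, τ)) t (hτ z t))
  have h2 : HasFDerivAt (fderiv ℝ F) (fderiv ℝ (fderiv ℝ F) (z, t)) (z, t) :=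
    (((hat (z, t) ht).fderiv_right (m := ∞) (by simp)).differentiableAt (by simp)).hasFDerivAt
  have hsymm := ((hat (z, t) ht).isSymmSndFDerivAt (by simp; norm_cast)).eq (1, 0) (0, 1)
  have h3 : HasDerivAt (fun τ => fderiv ℝ F (z, τ) (1, 0))
      (fderiv ℝ (fderiv ℝ F) (z, t) (0, 1) (1, 0)) t :=
    ((h2.comp_hasDerivAt (f := fun τ : ℝ => (z, τ)) t (hτ z t)).clm_apply
      (hasDerivAt_const t ((1 : ℝ), (0 : ℝ)))).congr_deriv (by simp)
  have h4 : HasDerivAt (fun x => fderiv ℝ F (x, t) (0, 1))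
      (fderiv ℝ (fderiv ℝ F) (z, t) (1, 0) (0, 1)) z :=
    ((h2.comp_hasDerivAt (f := fun x : ℝ => (x, t)) z (hz z t)).clm_apply
      (hasDerivAt_const z ((0 : ℝ), (1 : ℝ)))).congr_deriv (by simp)
  have h5 : (fun x => g x t) = fun x => fderiv ℝ F (x, t) (0, 1) := funext fun x => e2 x t ht
  rw [h5, h4.deriv, hsymm]
  refine h3.congr_of_eventuallyEq ?_
  filter_upwards [Ioo_mem_nhds ht.1 ht.2] with τ hτ'
  exact e1 z τ hτ'

/-- The commutator of time and arclength derivatives is -(φ_t/φ) times the arclength derivative,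
because arclength itself evolves. -/
lemma hasDerivAt_arcD (hpos : ∀ z, ∀ t ∈ Set.Ico 0 T, 0 < φ z t)
    (hφt : ∀ z, ∀ t ∈ Set.Ioo 0 T, HasDerivAt (fun τ => φ z τ) (φ z t * R z t) t)
    (hf : SmoothUpTo T f)
    (hg : ∀ z, ∀ t ∈ Set.Ioo 0 T, HasDerivAt (fun τ => f z τ) (g z t) t) (z : ℝ) {t : ℝ}
    (ht : t ∈ Set.Ioo 0 T) :
    HasDerivAt (fun τ => arcD φ f z τ) (arcD φ g z t - R z t * arcD φ f z t) t := by
  have h0 := (hpos z t (Set.Ioo_subset_Ico_self ht)).ne'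
  refine ((hasDerivAt_deriv_fst hf hg z ht).fun_div (hφt z t ht) h0).congr_deriv ?_
  simp only [arcD]
  field_simp

lemma arcD_eq_zero_and_arcD_arcD_nonpos (hφ : SmoothUpTo T φ)
    (hpos : ∀ z, ∀ t ∈ Set.Ico 0 T, 0 < φ z t) (hf : SmoothUpTo T f) {z t : ℝ}
    (ht : t ∈ Set.Ico 0 T) (hmax : ∀ x, f x t ≤ f z t) :
    arcD φ f z t = 0 ∧ arcD φ (arcD φ f) z t ≤ 0 := by
  have hd : deriv (fun x => f x t) z = 0 :=
    IsLocalMax.deriv_eq_zero (Filter.Eventually.of_forall hmax)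
  have h0 := hpos z t ht
  have h2 := deriv_deriv_nonpos_of_isMax ((hf.contDiff ht).of_le (by norm_cast)) hmax
  refine ⟨by simp [arcD, hd], ?_⟩
  have h3 : HasDerivAt (fun x => arcD φ f x t) _ z :=
    (((hf.deriv_fst.contDiff ht).differentiable (by simp) z).hasDerivAt).fun_div
      (((hφ.contDiff ht).differentiable (by simp) z).hasDerivAt) h0.ne'
  rw [arcD, h3.deriv]
  simp only [hd, zero_mul, sub_zero]
  have : deriv (fun x => deriv (fun x => f x t) x) z ≤ 0 := h2
  apply div_nonpos_of_nonpos_of_nonneg _ h0.le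
  apply div_nonpos_of_nonpos_of_nonneg _ (by positivity)
  exact mul_nonpos_of_nonpos_of_nonneg this h0.le

end

/-! ### The flow in logarithmic variables and the evolution of its derivatives. -/

/-- Half of the Ricci curvature of the fibre in the direction `E_i`, in terms of the quotients
`P_i = x_i / (x_j x_k)`. -/
def fibreRic (P : Fin 3 → ℝ) (i : Fin 3) : ℝ := P i ^ 2 - (P (i + 1) - P (i + 2)) ^ 2

/-- The arclength derivative of `P_i / P_i`, where `l` holds those of the `log x_i`. -/
def logDiff (l : Fin 3 → ℝ) (i : Fin 3) : ℝ := 2 * l i - ∑ j, l j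

/-- The first arclength derivative of `fibreRic`. -/
def fibreRicD (P l : Fin 3 → ℝ) (i : Fin 3) : ℝ :=
  2 * P i ^ 2 * logDiff l i - 2 * (P (i + 1) - P (i + 2)) *
    (P (i + 1) * logDiff l (i + 1) - P (i + 2) * logDiff l (i + 2))

/-- The second arclength derivative of `fibreRic`. -/
def fibreRicDD (P l m : Fin 3 → ℝ) (i : Fin 3) : ℝ :=
  2 * P i ^ 2 * (2 * logDiff l i ^ 2 + logDiff m i)
    - 2 * (P (i + 1) * logDiff l (i + 1) - P (i + 2) * logDiff l (i + 2)) ^ 2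
    - 2 * (P (i + 1) - P (i + 2)) * (P (i + 1) * (logDiff l (i + 1) ^ 2 + logDiff m (i + 1))
      - P (i + 2) * (logDiff l (i + 2) ^ 2 + logDiff m (i + 2)))

/-- The quotients `P_i = x_i / (x_j x_k)` in terms of `y_i = log x_i`. -/
def quot (y : Fin 3 → ℝ → ℝ → ℝ) (z t : ℝ) (i : Fin 3) : ℝ := Real.exp (2 * y i z t - ∑ j, y j z t)

/-- The Ricci flow of the metrics `φ² dz² + ∑ x_i² ω^i ⊗ ω^i`, in terms of `y_i = log x_i`. -/
structure LogFlow (T : ℝ) (φ : ℝ → ℝ → ℝ) (y : Fin 3 → ℝ → ℝ → ℝ) : Prop where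
  phi : IsWarpingFunction T φ
  smooth : ∀ i, SmoothUpTo T (y i)
  periodic : ∀ i, ∀ t ∈ Set.Ico 0 T, Function.Periodic (fun z => y i z t) (2 * Real.pi)
  phi_t : ∀ z, ∀ t ∈ Set.Ioo 0 T, HasDerivAt (fun τ => φ z τ)
    (φ z t * ∑ j, (arcD φ (arcD φ (y j)) z t + arcD φ (y j) z t ^ 2)) t
  y_t : ∀ i z, ∀ t ∈ Set.Ioo 0 T, HasDerivAt (fun τ => y i z τ)
    (arcD φ (arcD φ (y i)) z t + (∑ j, arcD φ (y j) z t) * arcD φ (y i) z t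
      - 2 * fibreRic (quot y z t) i) t

namespace LogFlow
variable {T : ℝ} {φ : ℝ → ℝ → ℝ} {y : Fin 3 → ℝ → ℝ → ℝ} (F : LogFlow T φ y)
include F

lemma smooth_arcD {f : ℝ → ℝ → ℝ} (hf : SmoothUpTo T f) : SmoothUpTo T (arcD φ f) :=
  SmoothUpTo.arcD F.phi.smooth F.phi.pos hf

lemma hasDerivAt_fst {f : ℝ → ℝ → ℝ} (hf : SmoothUpTo T f) (z : ℝ) {t : ℝ}
    (ht : t ∈ Set.Ico 0 T) : HasDerivAt (fun x => f x t) (φ z t * arcD φ f z t) z :=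
  hf.hasDerivAt ht (F.phi.pos z t ht)

lemma hasDerivAt_y (i : Fin 3) (z : ℝ) {t : ℝ} (ht : t ∈ Set.Ico 0 T) :
    HasDerivAt (fun x => y i x t) (φ z t * arcD φ (y i) z t) z :=
  F.hasDerivAt_fst (F.smooth i) z ht

lemma hasDerivAt_l (i : Fin 3) (z : ℝ) {t : ℝ} (ht : t ∈ Set.Ico 0 T) :
    HasDerivAt (fun x => arcD φ (y i) x t) (φ z t * arcD φ (arcD φ (y i)) z t) z :=
  F.hasDerivAt_fst (F.smooth_arcD (F.smooth i)) z ht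

lemma hasDerivAt_m (i : Fin 3) (z : ℝ) {t : ℝ} (ht : t ∈ Set.Ico 0 T) :
    HasDerivAt (fun x => arcD φ (arcD φ (y i)) x t)
      (φ z t * arcD φ (arcD φ (arcD φ (y i))) z t) z :=
  F.hasDerivAt_fst (F.smooth_arcD (F.smooth_arcD (F.smooth i))) z ht

lemma hasDerivAt_n (i : Fin 3) (z : ℝ) {t : ℝ} (ht : t ∈ Set.Ico 0 T) :
    HasDerivAt (fun x => arcD φ (arcD φ (arcD φ (y i))) x t)
      (φ z t * arcD φ (arcD φ (arcD φ (arcD φ (y i)))) z t) z :=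
  F.hasDerivAt_fst (F.smooth_arcD (F.smooth_arcD (F.smooth_arcD (F.smooth i)))) z ht

lemma hasDerivAt_sum_l (z : ℝ) {t : ℝ} (ht : t ∈ Set.Ico 0 T) :
    HasDerivAt (fun x => ∑ j, arcD φ (y j) x t)
      (φ z t * ∑ j, arcD φ (arcD φ (y j)) z t) z := by
  rw [Finset.mul_sum]
  exact HasDerivAt.fun_sum fun j _ => F.hasDerivAt_l j z ht

lemma hasDerivAt_quot (i : Fin 3) (z : ℝ) {t : ℝ} (ht : t ∈ Set.Ico 0 T) :
    HasDerivAt (fun x => quot y x t i)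
      (φ z t * (quot y z t i * logDiff (fun j => arcD φ (y j) z t) i)) z := by
  have h : HasDerivAt (fun x => 2 * y i x t - ∑ j, y j x t)
      (2 * (φ z t * arcD φ (y i) z t) - ∑ j, φ z t * arcD φ (y j) z t) z :=
    ((F.hasDerivAt_y i z ht).const_mul 2).sub
      (HasDerivAt.fun_sum fun j _ => F.hasDerivAt_y j z ht)
  refine h.exp.congr_deriv ?_
  rw [quot, logDiff, ← Finset.mul_sum]
  ring

lemma hasDerivAt_logDiff (i : Fin 3) (z : ℝ) {t : ℝ} (ht : t ∈ Set.Ico 0 T) :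
    HasDerivAt (fun x => logDiff (fun j => arcD φ (y j) x t) i)
      (φ z t * logDiff (fun j => arcD φ (arcD φ (y j)) z t) i) z :=
  (((F.hasDerivAt_l i z ht).const_mul 2).sub (F.hasDerivAt_sum_l z ht)).congr_deriv
    (by rw [logDiff]; ring)

lemma hasDerivAt_fibreRic (i : Fin 3) (z : ℝ) {t : ℝ} (ht : t ∈ Set.Ico 0 T) :
    HasDerivAt (fun x => fibreRic (quot y x t) i)
      (φ z t * fibreRicD (quot y z t) (fun j => arcD φ (y j) z t) i) z := by
  have h := fun i => F.hasDerivAt_quot i z ht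
  refine (((h i).fun_pow 2).fun_sub (((h (i + 1)).fun_sub (h (i + 2))).fun_pow 2)).congr_deriv ?_
  simp only [fibreRicD]
  ring

lemma hasDerivAt_fibreRicD (i : Fin 3) (z : ℝ) {t : ℝ} (ht : t ∈ Set.Ico 0 T) :
    HasDerivAt (fun x => fibreRicD (quot y x t) (fun j => arcD φ (y j) x t) i)
      (φ z t * fibreRicDD (quot y z t) (fun j => arcD φ (y j) z t)
        (fun j => arcD φ (arcD φ (y j)) z t) i) z := by
  have h := fun i => F.hasDerivAt_quot i z ht
  have h' := fun i => F.hasDerivAt_logDiff i z ht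
  refine (((((h i).fun_pow 2).const_mul 2).fun_mul (h' i)).fun_sub
    ((((h (i + 1)).fun_sub (h (i + 2))).const_mul 2).fun_mul
      (((h (i + 1)).fun_mul (h' (i + 1))).fun_sub
        ((h (i + 2)).fun_mul (h' (i + 2)))))).congr_deriv ?_
  simp only [fibreRicDD]
  ring

/-- The term (∑ m_j) l_i from differentiating the product cancels against the part ∑ m_j of φ_t/φ in
the commutator; the same cancellation, with m_i for l_i, occurs in `m_t`. -/
lemma l_t (i : Fin 3) (z : ℝ) {t : ℝ} (ht : t ∈ Set.Ioo 0 T) :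
    HasDerivAt (fun τ => arcD φ (y i) z τ)
      (arcD φ (arcD φ (arcD φ (y i))) z t
        + (∑ j, arcD φ (y j) z t) * arcD φ (arcD φ (y i)) z t
        - (∑ j, arcD φ (y j) z t ^ 2) * arcD φ (y i) z t
        - 2 * fibreRicD (quot y z t) (fun j => arcD φ (y j) z t) i) t := by
  have ht' := Set.Ioo_subset_Ico_self ht
  refine (hasDerivAt_arcD F.phi.pos F.phi_t (F.smooth i) (F.y_t i) z ht).congr_deriv ?_
  rw [arcD_eq_of_hasDerivAt (F.phi.pos z t ht') (((F.hasDerivAt_m i z ht').fun_add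
    ((F.hasDerivAt_sum_l z ht').fun_mul (F.hasDerivAt_l i z ht'))).fun_sub
      ((F.hasDerivAt_fibreRic i z ht').const_mul 2) |>.congr_deriv
    (g' := φ z t * (arcD φ (arcD φ (arcD φ (y i))) z t
      + ((∑ j, arcD φ (arcD φ (y j)) z t) * arcD φ (y i) z t
        + (∑ j, arcD φ (y j) z t) * arcD φ (arcD φ (y i)) z t)
      - 2 * fibreRicD (quot y z t) (fun j => arcD φ (y j) z t) i)) (by ring)),
    Finset.sum_add_distrib]
  ring

lemma m_t (i : Fin 3) (z : ℝ) {t : ℝ} (ht : t ∈ Set.Ioo 0 T) :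
    HasDerivAt (fun τ => arcD φ (arcD φ (y i)) z τ)
      (arcD φ (arcD φ (arcD φ (arcD φ (y i)))) z t
        + (∑ j, arcD φ (y j) z t) * arcD φ (arcD φ (arcD φ (y i))) z t
        - 2 * (∑ j, arcD φ (y j) z t ^ 2) * arcD φ (arcD φ (y i)) z t
        - 2 * (∑ j, arcD φ (y j) z t * arcD φ (arcD φ (y j)) z t) * arcD φ (y i) z t
        - 2 * fibreRicDD (quot y z t) (fun j => arcD φ (y j) z t)
          (fun j => arcD φ (arcD φ (y j)) z t) i) t := by
  have ht' := Set.Ioo_subset_Ico_self ht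
  have hsq : HasDerivAt (fun x => ∑ j, arcD φ (y j) x t ^ 2)
      (φ z t * (2 * ∑ j, arcD φ (y j) z t * arcD φ (arcD φ (y j)) z t)) z := by
    refine (HasDerivAt.fun_sum fun j _ => (F.hasDerivAt_l j z ht').fun_pow 2).congr_deriv ?_
    rw [Finset.mul_sum, Finset.mul_sum]
    refine Finset.sum_congr rfl fun j _ => ?_
    ring
  refine (hasDerivAt_arcD F.phi.pos F.phi_t (F.smooth_arcD (F.smooth i))
    (fun z t ht => F.l_t i z ht) z ht).congr_deriv ?_
  rw [arcD_eq_of_hasDerivAt (F.phi.pos z t ht') ((((F.hasDerivAt_n i z ht').fun_add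
    ((F.hasDerivAt_sum_l z ht').fun_mul (F.hasDerivAt_m i z ht'))).fun_sub
      (hsq.fun_mul (F.hasDerivAt_l i z ht'))).fun_sub
      ((F.hasDerivAt_fibreRicD i z ht').const_mul 2) |>.congr_deriv
    (g' := φ z t * (arcD φ (arcD φ (arcD φ (arcD φ (y i)))) z t
      + ((∑ j, arcD φ (arcD φ (y j)) z t) * arcD φ (arcD φ (y i)) z t
        + (∑ j, arcD φ (y j) z t) * arcD φ (arcD φ (arcD φ (y i))) z t)
      - ((2 * ∑ j, arcD φ (y j) z t * arcD φ (arcD φ (y j)) z t) * arcD φ (y i) z t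
        + (∑ j, arcD φ (y j) z t ^ 2) * arcD φ (arcD φ (y i)) z t)
      - 2 * fibreRicDD (quot y z t) (fun j => arcD φ (y j) z t)
          (fun j => arcD φ (arcD φ (y j)) z t) i)) (by ring)),
    Finset.sum_add_distrib]
  ring

end LogFlow

/-! ### Pointwise inequalities for the reaction terms. -/

lemma sum_fin_three_shift (f : Fin 3 → ℝ) (i : Fin 3) :
    ∑ j, f j = f i + f (i + 1) + f (i + 2) := by
  fin_cases i <;> simp [Fin.sum_univ_three] <;> ring

/-- For distinct i, j and the third index k, the difference of the two sides is 2 (P_i - P_j)(P_i +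
P_j - P_k), with both factors nonnegative. -/
lemma fibreRic_le_of_isMin_of_isMax {P : Fin 3 → ℝ} {i j : Fin 3} (hP : ∀ k, 0 < P k)
    (hi : ∀ k, P k ≤ P i) (hj : ∀ k, P j ≤ P k) : fibreRic P j ≤ fibreRic P i := by
  have h : ∀ k, 0 ≤ (P i - P j) * (P i - P k + P j) := fun k =>
    mul_nonneg (sub_nonneg.2 (hi j)) (by linarith [hi k, hP j])
  have h0 := h 0
  have h1 := h 1
  have h2 := h 2
  fin_cases i <;> fin_cases j <;> simp [fibreRic] at * <;> nlinarith

/-- After L_i³ cancels, the good terms are -G (L_j² + L_k²) and -2G (3 P_i² + (P_j - P_k)²). The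
remaining terms are linear in L_j and L_k with coefficients 4(P_i² ± (P_j² - P_k²)), at most 8Λ² in
absolute value. Completing the square absorbs them at a cost of 32Λ⁴/G, which 6 P_i² G beats because
P_i ≥ 1/Λ and G ≥ 3Λ³. -/
lemma gradient_reaction_neg {G Λ : ℝ} {P L : Fin 3 → ℝ} {i : Fin 3} (hΛ : 1 ≤ Λ)
    (hG : 3 * Λ ^ 3 ≤ G) (hP : ∀ k, 1 / Λ ≤ P k ∧ P k ≤ Λ) (hL : L i = G) :
    L i ^ 3 - (∑ j, L j ^ 2) * L i - 2 * (fibreRicD P L i + L i * fibreRic P i) < 0 := by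
  have hΛ0 : 0 < Λ := by linarith
  have hG0 : 0 < G := lt_of_lt_of_le (by positivity) hG
  have hP0 : ∀ k, 0 < P k := fun k => lt_of_lt_of_le (by positivity) (hP k).1
  have hsq : ∀ k, 0 ≤ P k ^ 2 ∧ P k ^ 2 ≤ Λ ^ 2 := fun k =>
    ⟨sq_nonneg _, pow_le_pow_left₀ (hP0 k).le (hP k).2 2⟩
  have key : ∀ c x : ℝ, |c| ≤ 8 * Λ ^ 2 → c * x ≤ G * x ^ 2 + 16 * Λ ^ 4 / G := by
    intro c x hc
    have h1 : c * x ≤ G * x ^ 2 + c ^ 2 / (4 * G) := by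
      have : 0 ≤ (2 * G * x - c) ^ 2 / (4 * G) := by positivity
      have e : (2 * G * x - c) ^ 2 / (4 * G) = G * x ^ 2 - c * x + c ^ 2 / (4 * G) := by
        field_simp
        ring
      linarith
    have h2 : c ^ 2 / (4 * G) ≤ 16 * Λ ^ 4 / G := by
      have : c ^ 2 ≤ (8 * Λ ^ 2) ^ 2 := sq_le_sq' (abs_le.1 hc).1 (abs_le.1 hc).2
      rw [div_le_div_iff₀ (by positivity) hG0]
      nlinarith
    linarith
  have hlow : 32 * Λ ^ 4 / G < 6 * P i ^ 2 * G := by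
    have h1 : (1 / Λ) ^ 2 ≤ P i ^ 2 := pow_le_pow_left₀ (by positivity) (hP i).1 2
    have h2 : 9 * Λ ^ 6 ≤ G ^ 2 := by
      calc 9 * Λ ^ 6 = (3 * Λ ^ 3) ^ 2 := by ring
        _ ≤ G ^ 2 := pow_le_pow_left₀ (by positivity) hG 2
    rw [div_lt_iff₀ hG0]
    calc 32 * Λ ^ 4 < 54 * Λ ^ 4 := by nlinarith [pow_pos hΛ0 4]
      _ = 6 * (1 / Λ) ^ 2 * (9 * Λ ^ 6) := by field_simp; norm_num
      _ ≤ 6 * P i ^ 2 * G ^ 2 := by gcongr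
      _ = 6 * P i ^ 2 * G * G := by ring
  have hc : ∀ a b c : ℝ, 0 ≤ a ∧ a ≤ Λ ^ 2 → 0 ≤ b ∧ b ≤ Λ ^ 2 → 0 ≤ c ∧ c ≤ Λ ^ 2 →
      |4 * (a + b - c)| ≤ 8 * Λ ^ 2 := by
    intro a b c ha hb hc
    rw [abs_le]
    constructor <;> linarith [ha.1, ha.2, hb.1, hb.2, hc.1, hc.2]
  have k1 := key _ (L (i + 1)) (hc _ _ _ (hsq i) (hsq (i + 1)) (hsq (i + 2)))
  have k2 := key _ (L (i + 2)) (hc _ _ _ (hsq i) (hsq (i + 2)) (hsq (i + 1)))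
  have k3 : 0 ≤ (P (i + 1) - P (i + 2)) ^ 2 * G := by positivity
  have e : 16 * Λ ^ 4 / G + 16 * Λ ^ 4 / G = 32 * Λ ^ 4 / G := by ring
  simp only [fibreRicD, fibreRic, logDiff, sum_fin_three_shift _ i, hL]
  nlinarith

/-- Since s M_i = N - L_i², the term -2 M_i² is -2N² up to 4B⁴N. The other terms contribute at most
(24 + 1112 + 200) B⁴N, a total of 1340 B⁴N, whereas 2N² ≥ 1400 B⁴N. -/
lemma curvature_reaction_neg {B N s : ℝ} {P L M : Fin 3 → ℝ} {i : Fin 3} (hs : s = 1 ∨ s = -1)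
    (hB : 1 ≤ B) (hN : 700 * B ^ 4 ≤ N) (hP : ∀ k, |P k| ≤ B) (hL : ∀ k, |L k| ≤ B)
    (hM : ∀ k, |M k| ≤ B * N) (hw : s * M i + L i ^ 2 = N) :
    -2 * M i ^ 2 + (4 * L i ^ 2 - 4 * fibreRic P i) * N
      - 2 * s * ((∑ j, L j ^ 2) * M i + (∑ j, L j * M j) * L i + fibreRicDD P L M i)
      - 2 * L i ^ 2 * (∑ j, L j ^ 2) - 4 * L i * fibreRicD P L i < 0 := by
  have hB0 : 0 < B := by linarith
  have hN0 : 0 < N := lt_of_lt_of_le (by positivity) hN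
  have mulb : ∀ {a b A A' : ℝ}, |a| ≤ A → |b| ≤ A' → |a * b| ≤ A * A' := by
    intro a b A A' ha hb
    rw [abs_mul]
    exact mul_le_mul ha hb (abs_nonneg _) ((abs_nonneg _).trans ha)
  have addb : ∀ {a b A A' : ℝ}, |a| ≤ A → |b| ≤ A' → |a + b| ≤ A + A' :=
    fun ha hb => (abs_add_le _ _).trans (add_le_add ha hb)
  have subb : ∀ {a b A A' : ℝ}, |a| ≤ A → |b| ≤ A' → |a - b| ≤ A + A' :=
    fun ha hb => (abs_sub _ _).trans (add_le_add ha hb)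
  have sqb : ∀ {a A : ℝ}, |a| ≤ A → |a ^ 2| ≤ A ^ 2 := fun ha => by
    rw [pow_two, pow_two]
    exact mulb ha ha
  have two : |(2 : ℝ)| ≤ 2 := by norm_num
  have hlog : ∀ {v : Fin 3 → ℝ} {A : ℝ}, (∀ k, |v k| ≤ A) → ∀ k, |logDiff v k| ≤ 5 * A := by
    intro v A hv k
    rw [logDiff, sum_fin_three_shift _ k]
    refine (subb (mulb two (hv k)) (addb (addb (hv k) (hv (k + 1))) (hv (k + 2)))).trans ?_
    linarith
  have hBN : B ^ 2 * N ≤ B ^ 4 * N :=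
    mul_le_mul_of_nonneg_right (pow_le_pow_right₀ hB (by norm_num)) hN0.le
  have hBN3 : B ^ 3 * N ≤ B ^ 4 * N :=
    mul_le_mul_of_nonneg_right (pow_le_pow_right₀ hB (by norm_num)) hN0.le
  have hB4 : B ^ 4 ≤ B ^ 4 * N := le_mul_of_one_le_right (by positivity)
    (le_trans (by nlinarith [one_le_pow₀ hB (n := 4)]) hN)
  have hdiff : |P (i + 1) - P (i + 2)| ≤ B + B := subb (hP _) (hP _)
  have bF : |fibreRic P i| ≤ 5 * B ^ 2 :=
    (subb (sqb (hP i)) (sqb hdiff)).trans (by nlinarith)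
  have bFD : |fibreRicD P L i| ≤ 50 * B ^ 3 :=
    (subb (mulb (mulb two (sqb (hP i))) (hlog hL i)) (mulb (mulb two hdiff)
      (subb (mulb (hP (i + 1)) (hlog hL (i + 1))) (mulb (hP (i + 2)) (hlog hL (i + 2)))))).trans
      (by nlinarith [pow_pos hB0 3])
  have bFDD : |fibreRicDD P L M i| ≤ 550 * (B ^ 4 * N) := by
    have hin : ∀ k, |P k * (logDiff L k ^ 2 + logDiff M k)| ≤ B * ((5 * B) ^ 2 + 5 * (B * N)) :=
      fun k => mulb (hP k) (addb (sqb (hlog hL k)) (hlog hM k))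
    refine (subb (subb (mulb (mulb two (sqb (hP i))) (addb (mulb two (sqb (hlog hL i)))
      (hlog hM i))) (mulb two (sqb (subb (mulb (hP (i + 1)) (hlog hL (i + 1)))
      (mulb (hP (i + 2)) (hlog hL (i + 2))))))) (mulb (mulb two hdiff)
      (subb (hin (i + 1)) (hin (i + 2))))).trans ?_
    nlinarith
  have bS : |∑ j, L j ^ 2| ≤ 3 * B ^ 2 := by
    rw [sum_fin_three_shift _ i]
    refine (addb (addb (sqb (hL i)) (sqb (hL (i + 1)))) (sqb (hL (i + 2)))).trans ?_
    linarith
  have bLM : |∑ j, L j * M j| ≤ 3 * (B * (B * N)) := by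
    rw [sum_fin_three_shift _ i]
    refine (addb (addb (mulb (hL i) (hM i)) (mulb (hL (i + 1)) (hM (i + 1))))
      (mulb (hL (i + 2)) (hM (i + 2)))).trans ?_
    linarith
  have hS0 : 0 ≤ 2 * L i ^ 2 * ∑ j, L j ^ 2 := by positivity
  have t1 : (4 * L i ^ 2 - 4 * fibreRic P i) * N ≤ 24 * (B ^ 4 * N) := by
    have h1 := (abs_le.1 (sqb (hL i))).2
    have h2 := (abs_le.1 bF).1
    have h3 : 4 * L i ^ 2 - 4 * fibreRic P i ≤ 24 * B ^ 2 := by linarith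
    calc _ ≤ 24 * B ^ 2 * N := mul_le_mul_of_nonneg_right h3 hN0.le
      _ ≤ _ := by linarith
  have t2 : |(∑ j, L j ^ 2) * M i + (∑ j, L j * M j) * L i + fibreRicDD P L M i| ≤
      556 * (B ^ 4 * N) := by
    refine (addb (addb (mulb bS (hM i)) (mulb bLM (hL i))) bFDD).trans ?_
    nlinarith
  have t2' : -2 * s * ((∑ j, L j ^ 2) * M i + (∑ j, L j * M j) * L i + fibreRicDD P L M i) ≤
      1112 * (B ^ 4 * N) := by
    rcases hs with rfl | rfl <;> linarith [(abs_le.1 t2).1, (abs_le.1 t2).2]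
  have t3 : -(4 * L i * fibreRicD P L i) ≤ 200 * (B ^ 4 * N) := by
    have h1 := (abs_le.1 (mulb (hL i) bFD)).1
    nlinarith
  have t4 : -2 * M i ^ 2 ≤ -2 * N ^ 2 + 4 * (B ^ 4 * N) := by
    have h1 : M i ^ 2 = (N - L i ^ 2) ^ 2 := by
      rw [← hw]
      rcases hs with rfl | rfl <;> ring
    have h2 := (abs_le.1 (sqb (hL i))).2
    have h3 : L i ^ 2 * N ≤ B ^ 2 * N := mul_le_mul_of_nonneg_right h2 hN0.le
    rw [h1]
    nlinarith [sq_nonneg (L i ^ 2)]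
  have t5 : 700 * (B ^ 4 * N) ≤ N ^ 2 := by nlinarith
  have t6 : 0 < B ^ 4 * N := by positivity
  linarith

lemma quot_pos (y : Fin 3 → ℝ → ℝ → ℝ) (z t : ℝ) (i : Fin 3) : 0 < quot y z t i := Real.exp_pos _

/-- The number x_i P_k is a product of at most two ratios of radii, each between e^{-c} and e^c. -/
lemma exp_mul_quot_mem {y : Fin 3 → ℝ → ℝ → ℝ} {c z t : ℝ}
    (hy : ∀ i j, y i z t - y j z t ≤ c) (i k : Fin 3) :
    1 / Real.exp (2 * c) ≤ Real.exp (y i z t) * quot y z t k ∧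
      Real.exp (y i z t) * quot y z t k ≤ Real.exp (2 * c) := by
  rw [quot, ← Real.exp_add, one_div, ← Real.exp_neg, Real.exp_le_exp, Real.exp_le_exp]
  fin_cases i <;> fin_cases k <;> simp [Fin.sum_univ_three] <;>
  constructor <;> linarith [hy 0 0, hy 0 1, hy 0 2, hy 1 0, hy 1 2, hy 2 0, hy 2 1]

/-! ### The three estimates along the flow. -/

namespace LogFlow
variable {T : ℝ} {φ : ℝ → ℝ → ℝ} {y : Fin 3 → ℝ → ℝ → ℝ} (F : LogFlow T φ y)
include F

lemma derivative_tests {v : ℝ → ℝ → ℝ} {v₁ : ℝ → ℝ} {v₂ z t : ℝ} (hv : SmoothUpTo T v)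
    (ht : t ∈ Set.Ico 0 T) (h₁ : ∀ x, HasDerivAt (fun x => v x t) (φ x t * v₁ x) x)
    (h₂ : HasDerivAt v₁ (φ z t * v₂) z) (hmax : ∀ x, v x t ≤ v z t) : v₁ z = 0 ∧ v₂ ≤ 0 := by
  have e : ∀ x, arcD φ v x t = v₁ x := fun x => arcD_eq_of_hasDerivAt (F.phi.pos x t ht) (h₁ x)
  have h := arcD_eq_zero_and_arcD_arcD_nonpos F.phi.smooth F.phi.pos hv ht hmax
  rw [e] at h
  refine ⟨h.1, ?_⟩
  rw [arcD_eq_of_hasDerivAt (d := v₂) (F.phi.pos z t ht)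
    (h₂.congr_of_eventuallyEq (Filter.Eventually.of_forall e))] at h
  exact h.2

theorem sub_le {c : ℝ} (h0 : ∀ i j z, y i z 0 - y j z 0 ≤ c) :
    ∀ i j, ∀ t ∈ Set.Ico 0 T, ∀ z, y i z t - y j z t ≤ c := by
  -- The reaction term is only nonpositive here, so the barrier ε(1 + t) supplies the strictness; ε
  -- is arbitrary.
  have main : ∀ ε > 0, ∀ p : Fin 3 × Fin 3, ∀ t ∈ Set.Ico 0 T, ∀ z,
      y p.1 z t - y p.2 z t - c - ε * (1 + t) < 0 := by
    intro ε hε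
    have hsm : ∀ p : Fin 3 × Fin 3,
        SmoothUpTo T (fun z t => y p.1 z t - y p.2 z t - c - ε * (1 + t)) := fun p =>
      (((F.smooth p.1).sub (F.smooth p.2)).sub contDiffOn_const).sub
        (contDiffOn_const.mul (contDiffOn_const.add contDiff_snd.contDiffOn))
    refine neg_of_deriv_neg_at_first_zero
      (u := fun p z t => y p.1 z t - y p.2 z t - c - ε * (1 + t))
      (L := 2 * Real.pi) (by positivity) (fun p => (hsm p).continuousOn) ?_ ?_ ?_
    · intro p t ht z
      have h1 : y p.1 (z + 2 * Real.pi) t = y p.1 z t := F.periodic p.1 t ht z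
      have h2 : y p.2 (z + 2 * Real.pi) t = y p.2 z t := F.periodic p.2 t ht z
      simp only [h1, h2]
    · intro p z
      have := h0 p.1 p.2 z
      linarith
    · rintro ⟨i, j⟩ z t ht hle hzero
      have ht' := Set.Ioo_subset_Ico_self ht
      simp only at hzero
      obtain ⟨hd1, hd2⟩ := F.derivative_tests (hsm (i, j)) ht'
        (fun x => (((F.hasDerivAt_y i x ht').sub (F.hasDerivAt_y j x ht')).sub_const c
          |>.sub_const (ε * (1 + t))).congr_deriv
            (show _ = φ x t * (arcD φ (y i) x t - arcD φ (y j) x t) by ring))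
        (((F.hasDerivAt_l i z ht').sub (F.hasDerivAt_l j z ht')).congr_deriv
          (show _ = φ z t * (arcD φ (arcD φ (y i)) z t - arcD φ (arcD φ (y j)) z t) by ring))
        (fun x => by rw [hzero]; exact hle (i, j) x)
      refine ⟨_, ?_, (((F.y_t i z t ht).fun_sub (F.y_t j z t ht)).sub_const c).fun_sub
        (((hasDerivAt_id' t).const_add 1).const_mul ε)⟩
      -- All pairs obey the same barrier and (i, j) attains it, so y_i is the largest and y_j the
      -- smallest of the three at this point, and the P_k are ordered like the y_k.
      have hric : fibreRic (quot y z t) j ≤ fibreRic (quot y z t) i := by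
        refine fibreRic_le_of_isMin_of_isMax (quot_pos y z t) (fun k => ?_) (fun k => ?_) <;>
        · rw [quot, quot, Real.exp_le_exp]
          have h1 := hle (i, k) z
          have h2 := hle (k, j) z
          simp only at h1 h2
          linarith
      rw [sub_eq_zero] at hd1
      rw [hd1]
      linarith
  intro i j t ht z
  by_contra! h
  have h1 : 0 < 1 + t := by linarith [ht.1]
  have := main ((y i z t - y j z t - c) / (1 + t)) (div_pos (by linarith) h1) (i, j) t ht z
  rw [div_mul_cancel₀ _ h1.ne'] at this
  simp at this

theorem abs_gradient_lt {c G : ℝ} (hc : 0 ≤ c)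
    (hy : ∀ i j, ∀ t ∈ Set.Ico 0 T, ∀ z, y i z t - y j z t ≤ c)
    (hG : 3 * Real.exp (2 * c) ^ 3 ≤ G)
    (h0 : ∀ i z, |Real.exp (y i z 0) * arcD φ (y i) z 0| < G) :
    ∀ i, ∀ t ∈ Set.Ico 0 T, ∀ z, |Real.exp (y i z t) * arcD φ (y i) z t| < G := by
  -- The sign turns the bound on an absolute value into two one-sided bounds. The reaction is
  -- strictly negative at the level G, so no ε is needed.
  have main : ∀ p : Fin 3 × ({1, -1} : Set ℝ), ∀ t ∈ Set.Ico 0 T, ∀ z,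
      p.2 * (Real.exp (y p.1 z t) * arcD φ (y p.1) z t) - G < 0 := by
    have hsm : ∀ p : Fin 3 × ({1, -1} : Set ℝ),
        SmoothUpTo T (fun z t => p.2 * (Real.exp (y p.1 z t) * arcD φ (y p.1) z t) - G) :=
      fun p => (contDiffOn_const.mul
        ((F.smooth p.1).exp.mul (F.smooth_arcD (F.smooth p.1)))).sub contDiffOn_const
    refine neg_of_deriv_neg_at_first_zero
      (u := fun (p : Fin 3 × ({1, -1} : Set ℝ)) z t =>
        p.2 * (Real.exp (y p.1 z t) * arcD φ (y p.1) z t) - G)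
      (L := 2 * Real.pi) (by positivity) (fun p => (hsm p).continuousOn) ?_ ?_ ?_
    · intro p t ht z
      have h1 : y p.1 (z + 2 * Real.pi) t = y p.1 z t := F.periodic p.1 t ht z
      have h2 : arcD φ (y p.1) (z + 2 * Real.pi) t = arcD φ (y p.1) z t :=
        arcD_periodic (F.phi.periodic t ht) (F.periodic p.1 t ht) z
      simp only [h1, h2]
    · rintro ⟨i, s, hs⟩ z
      have h := abs_lt.1 (h0 i z)
      rcases hs with rfl | rfl <;> simp only <;> linarith
    · rintro ⟨i, s, hs⟩ z t ht hle hzero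
      have ht' := Set.Ioo_subset_Ico_self ht
      simp only at hzero
      obtain ⟨hd1, hd2⟩ := F.derivative_tests (hsm (i, ⟨s, hs⟩)) ht'
        (fun x => ((((F.hasDerivAt_y i x ht').exp.fun_mul (F.hasDerivAt_l i x ht')).const_mul
          s).sub_const G).congr_deriv (show _ = φ x t * (s * (Real.exp (y i x t) *
            (arcD φ (y i) x t ^ 2 + arcD φ (arcD φ (y i)) x t))) by ring))
        ((((F.hasDerivAt_y i z ht').exp.fun_mul (((F.hasDerivAt_l i z ht').fun_pow 2).fun_add
          (F.hasDerivAt_m i z ht'))).const_mul s).congr_deriv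
          (show _ = φ z t * (s * (Real.exp (y i z t) *
            (arcD φ (y i) z t * (arcD φ (y i) z t ^ 2 + arcD φ (arcD φ (y i)) z t)
              + 2 * arcD φ (y i) z t * arcD φ (arcD φ (y i)) z t
              + arcD φ (arcD φ (arcD φ (y i))) z t))) by push_cast; ring))
        (fun x => by rw [hzero]; exact hle (i, ⟨s, hs⟩) x)
      refine ⟨_, ?_, (((F.y_t i z t ht).exp.fun_mul (F.l_t i z ht)).const_mul s).sub_const G⟩
      have hx := Real.exp_pos (y i z t)
      have hΛ : 1 ≤ Real.exp (2 * c) := Real.one_le_exp (by positivity)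
      have hreact := gradient_reaction_neg (P := fun k => Real.exp (y i z t) * quot y z t k)
        (L := fun k => s * (Real.exp (y i z t) * arcD φ (y k) z t)) (i := i) hΛ hG
        (exp_mul_quot_mem (fun i j => hy i j t ht' z) i) (by linarith)
      simp only [fibreRicD, fibreRic, logDiff, sum_fin_three_shift _ i] at hreact ⊢
      generalize Real.exp (y i z t) = x at *
      generalize arcD φ (arcD φ (arcD φ (y i))) z t = n at *
      generalize arcD φ (arcD φ (y i)) z t = m at *
      generalize arcD φ (y i) z t = l₁ at *
      generalize arcD φ (y (i + 1)) z t = l₂ at *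
      generalize arcD φ (y (i + 2)) z t = l₃ at *
      generalize quot y z t i = P₁ at *
      generalize quot y z t (i + 1) = P₂ at *
      generalize quot y z t (i + 2) = P₃ at *
      have hs2 : s * s = 1 := by rcases hs with rfl | rfl <;> norm_num
      have hs0 : s ≠ 0 := by rintro rfl; norm_num at hs2
      -- At a spatial extremum of x_i' the derivative x_i'' = x_i (m_i + l_i²) vanishes.
      have hm : m = -l₁ ^ 2 := by
        have := (mul_eq_zero.1 ((mul_eq_zero.1 hd1).resolve_left hs0)).resolve_left hx.ne'
        linarith
      subst hm
      -- Multiplying by x_i² makes the time derivative scale invariant; it is then the rescaled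
      -- reaction term plus a nonpositive second-derivative term.
      refine neg_of_mul_neg_right ?_ (pow_pos hx 2).le
      refine lt_of_le_of_lt (le_of_sub_nonpos ?_) hreact
      have := mul_nonpos_of_nonneg_of_nonpos (pow_pos hx 2).le hd2
      refine le_of_eq_of_le ?_ this
      rcases hs with rfl | rfl <;> ring
  intro i t ht z
  have h1 := main (i, ⟨1, by simp⟩) t ht z
  have h2 := main (i, ⟨-1, by simp⟩) t ht z
  simp only at h1 h2
  rw [abs_lt]
  constructor <;> linarith

theorem curvature_lt {c G N : ℝ} (hc : 0 ≤ c) (hG1 : 1 ≤ G)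
    (hy : ∀ i j, ∀ t ∈ Set.Ico 0 T, ∀ z, y i z t - y j z t ≤ c)
    (hG : ∀ i, ∀ t ∈ Set.Ico 0 T, ∀ z, |Real.exp (y i z t) * arcD φ (y i) z t| ≤ G)
    (hN : 700 * (Real.exp (2 * c) * G) ^ 4 ≤ N)
    (h0 : ∀ i z, ∀ s ∈ ({1, -1} : Set ℝ), Real.exp (2 * y i z 0) *
      (s * arcD φ (arcD φ (y i)) z 0 + arcD φ (y i) z 0 ^ 2) < N) :
    ∀ i, ∀ t ∈ Set.Ico 0 T, ∀ z, ∀ s ∈ ({1, -1} : Set ℝ), Real.exp (2 * y i z t) *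
      (s * arcD φ (arcD φ (y i)) z t + arcD φ (y i) z t ^ 2) < N := by
  have main : ∀ p : Fin 3 × ({1, -1} : Set ℝ), ∀ t ∈ Set.Ico 0 T, ∀ z,
      Real.exp (2 * y p.1 z t) * (p.2 * arcD φ (arcD φ (y p.1)) z t + arcD φ (y p.1) z t ^ 2)
        - N < 0 := by
    have hsm : ∀ p : Fin 3 × ({1, -1} : Set ℝ), SmoothUpTo T (fun z t =>
        Real.exp (2 * y p.1 z t) * (p.2 * arcD φ (arcD φ (y p.1)) z t + arcD φ (y p.1) z t ^ 2)
          - N) :=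
      fun p => ((contDiffOn_const.mul (F.smooth p.1)).exp.mul
        ((contDiffOn_const.mul (F.smooth_arcD (F.smooth_arcD (F.smooth p.1)))).add
          ((F.smooth_arcD (F.smooth p.1)).pow 2))).sub contDiffOn_const
    refine neg_of_deriv_neg_at_first_zero
      (u := fun (p : Fin 3 × ({1, -1} : Set ℝ)) z t => Real.exp (2 * y p.1 z t) *
        (p.2 * arcD φ (arcD φ (y p.1)) z t + arcD φ (y p.1) z t ^ 2) - N)
      (L := 2 * Real.pi) (by positivity) (fun p => (hsm p).continuousOn) ?_ ?_ ?_
    · intro p t ht z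
      have h1 : y p.1 (z + 2 * Real.pi) t = y p.1 z t := F.periodic p.1 t ht z
      have h2 := arcD_periodic (F.phi.periodic t ht) (F.periodic p.1 t ht)
      have h3 : arcD φ (arcD φ (y p.1)) (z + 2 * Real.pi) t = arcD φ (arcD φ (y p.1)) z t :=
        arcD_periodic (F.phi.periodic t ht) h2 z
      have h2' : arcD φ (y p.1) (z + 2 * Real.pi) t = arcD φ (y p.1) z t := h2 z
      simp only [h1, h2', h3]
    · rintro ⟨i, s, hs⟩ z
      simpa using h0 i z s hs
    · rintro ⟨i, s, hs⟩ z t ht hle hzero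
      have ht' := Set.Ioo_subset_Ico_self ht
      simp only at hzero
      have he : ∀ k, Real.exp (2 * y k z t) = Real.exp (y k z t) ^ 2 := fun k => by
        rw [pow_two, ← Real.exp_add]
        congr 1
        ring
      have hs' : s = 1 ∨ s = -1 := hs
      obtain ⟨hd1, hd2⟩ := F.derivative_tests (hsm (i, ⟨s, hs⟩)) ht'
        (fun x => (((((F.hasDerivAt_y i x ht').const_mul 2).exp.fun_mul
          (((F.hasDerivAt_m i x ht').const_mul s).fun_add
            ((F.hasDerivAt_l i x ht').fun_pow 2))).sub_const N).congr_deriv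
          (show _ = φ x t * (Real.exp (2 * y i x t) *
            (2 * arcD φ (y i) x t * (s * arcD φ (arcD φ (y i)) x t + arcD φ (y i) x t ^ 2)
              + (s * arcD φ (arcD φ (arcD φ (y i))) x t
                + 2 * arcD φ (y i) x t * arcD φ (arcD φ (y i)) x t))) by push_cast; ring)))
        ((((F.hasDerivAt_y i z ht').const_mul 2).exp.fun_mul
          ((((F.hasDerivAt_l i z ht').const_mul 2).fun_mul
            (((F.hasDerivAt_m i z ht').const_mul s).fun_add
              ((F.hasDerivAt_l i z ht').fun_pow 2))).fun_add
            (((F.hasDerivAt_n i z ht').const_mul s).fun_add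
              (((F.hasDerivAt_l i z ht').const_mul 2).fun_mul
                (F.hasDerivAt_m i z ht'))))).congr_deriv
          (show _ = φ z t * (Real.exp (2 * y i z t) *
            (4 * arcD φ (y i) z t ^ 2 * (s * arcD φ (arcD φ (y i)) z t + arcD φ (y i) z t ^ 2)
              + 2 * arcD φ (arcD φ (y i)) z t *
                (s * arcD φ (arcD φ (y i)) z t + arcD φ (y i) z t ^ 2)
              + 4 * arcD φ (y i) z t * (s * arcD φ (arcD φ (arcD φ (y i))) z t
                + 2 * arcD φ (y i) z t * arcD φ (arcD φ (y i)) z t)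
              + (s * arcD φ (arcD φ (arcD φ (arcD φ (y i)))) z t
                + 2 * arcD φ (arcD φ (y i)) z t ^ 2
                + 2 * arcD φ (y i) z t * arcD φ (arcD φ (arcD φ (y i))) z t)))
            by push_cast; ring))
        (fun x => by rw [hzero]; exact hle (i, ⟨s, hs⟩) x)
      refine ⟨_, ?_, ((((F.y_t i z t ht).const_mul 2).exp.fun_mul
        (((F.m_t i z ht).const_mul s).fun_add ((F.l_t i z ht).fun_pow 2)))).sub_const N⟩
      have hx := Real.exp_pos (y i z t)
      have hcmp : ∀ k, Real.exp (y i z t) ≤ Real.exp c * Real.exp (y k z t) := fun k => by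
        rw [← Real.exp_add, Real.exp_le_exp]
        linarith [hy i k t ht' z]
      have hΛ : 1 ≤ Real.exp c := Real.one_le_exp hc
      have hΛ2 : Real.exp (2 * c) = Real.exp c ^ 2 := by
        rw [pow_two, ← Real.exp_add]
        congr 1
        ring
      have hc1 : Real.exp c ≤ Real.exp (2 * c) := by rw [hΛ2]; nlinarith
      have hc2 : Real.exp (2 * c) ≤ Real.exp (2 * c) * G :=
        le_mul_of_one_le_right (Real.exp_pos _).le hG1
      have hB : 1 ≤ Real.exp (2 * c) * G := by linarith
      have hN0 : 0 ≤ N := le_trans (by positivity) hN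
      -- Everything is rescaled by powers of x_i at the point, with B = e^{2c} G.
      have hreact := curvature_reaction_neg (i := i)
        (P := fun k => Real.exp (y i z t) * quot y z t k)
        (L := fun k => Real.exp (y i z t) * arcD φ (y k) z t)
        (M := fun k => Real.exp (y i z t) ^ 2 * arcD φ (arcD φ (y k)) z t) hs' hB hN
        (fun k => by
          rw [abs_of_pos (mul_pos hx (quot_pos y z t k))]
          exact (exp_mul_quot_mem (fun i j => hy i j t ht' z) i k).2.trans hc2)
        (fun k => by
          have h1 := hG k t ht' z
          rw [abs_mul, abs_of_pos (Real.exp_pos _)] at h1 ⊢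
          calc _ ≤ Real.exp c * Real.exp (y k z t) * |arcD φ (y k) z t| :=
                mul_le_mul_of_nonneg_right (hcmp k) (abs_nonneg _)
            _ = Real.exp c * (Real.exp (y k z t) * |arcD φ (y k) z t|) := by ring
            _ ≤ Real.exp (2 * c) * G := mul_le_mul hc1 h1 (by positivity) (by positivity))
        (fun k => by
          -- The reaction couples all three directions: the barriers for both signs in direction k
          -- bound x_k² |m_k| by N, and comparability replaces x_k by x_i.
          have h1 := hle (k, ⟨1, by simp⟩) z
          have h2 := hle (k, ⟨-1, by simp⟩) z
          simp only [he] at h1 h2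
          have h3 : Real.exp (y k z t) ^ 2 * |arcD φ (arcD φ (y k)) z t| ≤ N := by
            have h4 : 0 ≤ Real.exp (y k z t) ^ 2 * arcD φ (y k) z t ^ 2 := by positivity
            rcases abs_cases (arcD φ (arcD φ (y k)) z t) with h | h <;> rw [h.1] <;> linarith
          rw [abs_mul, abs_of_pos (pow_pos hx 2)]
          calc _ ≤ (Real.exp c * Real.exp (y k z t)) ^ 2 * |arcD φ (arcD φ (y k)) z t| :=
                mul_le_mul_of_nonneg_right (pow_le_pow_left₀ hx.le (hcmp k) 2) (abs_nonneg _)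
            _ = Real.exp (2 * c) * (Real.exp (y k z t) ^ 2 * |arcD φ (arcD φ (y k)) z t|) := by
                rw [hΛ2]; ring
            _ ≤ Real.exp (2 * c) * G * N := mul_le_mul hc2 h3 (by positivity) (by positivity))
        (by rw [he] at hzero; linarith)
      rw [he] at hzero hd1 hd2
      have hN' : N = Real.exp (y i z t) ^ 2 *
          (s * arcD φ (arcD φ (y i)) z t + arcD φ (y i) z t ^ 2) := by linarith
      rw [hN'] at hreact
      clear hN' hzero hN hN0 h0 hG hle hsm
      simp only [he, fibreRicDD, fibreRicD, fibreRic, logDiff, sum_fin_three_shift _ i]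
        at hreact ⊢
      generalize Real.exp (y i z t) = x at *
      generalize arcD φ (arcD φ (arcD φ (arcD φ (y i)))) z t = r at *
      generalize arcD φ (arcD φ (arcD φ (y i))) z t = n at *
      generalize arcD φ (arcD φ (y i)) z t = m₁ at *
      generalize arcD φ (arcD φ (y (i + 1))) z t = m₂ at *
      generalize arcD φ (arcD φ (y (i + 2))) z t = m₃ at *
      generalize arcD φ (y i) z t = l₁ at *
      generalize arcD φ (y (i + 1)) z t = l₂ at *
      generalize arcD φ (y (i + 2)) z t = l₃ at *
      generalize quot y z t i = P₁ at *
      generalize quot y z t (i + 1) = P₂ at *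
      generalize quot y z t (i + 2) = P₃ at *
      have hs2 : s * s = 1 := by rcases hs' with rfl | rfl <;> norm_num
      -- The vanishing spatial gradient eliminates the third derivative of y_i.
      have hn : n = s * (-2 * l₁ * (s * m₁ + l₁ ^ 2) - 2 * l₁ * m₁) := by
        have := (mul_eq_zero.1 hd1).resolve_left (pow_pos hx 2).ne'
        linear_combination s * this - n * hs2
      subst hn
      refine neg_of_mul_neg_right ?_ (pow_pos hx 2).le
      refine lt_of_le_of_lt (le_of_sub_nonpos ?_) hreact
      have := mul_nonpos_of_nonneg_of_nonpos (pow_pos hx 2).le hd2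
      refine le_of_eq_of_le ?_ this
      push_cast
      rcases hs' with rfl | rfl <;> ring
  intro i t ht z s hs
  exact sub_neg.1 (main (i, ⟨s, hs⟩) t ht z)

end LogFlow

/-! ### From the geometric Ricci flow to the logarithmic system. -/

lemma snd_ne_zero_of_mem_cylinder {p : Ambient} (hp : p ∈ cylinder) : p.2 ≠ 0 := by
  rintro h
  simp [cylinder, h] at hp

/-- The logarithms of the warping functions `a, b, c`. -/
def logWarp (a b c : ℝ → ℝ → ℝ) (i : Fin 3) (z t : ℝ) : ℝ := Real.log (![a, b, c] i z t)

section
variable {T : ℝ} {φ a b c : ℝ → ℝ → ℝ}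

lemma metricAt_eq_diagMetric (φ a b c : ℝ → ℝ → ℝ) (t : ℝ) :
    metricAt φ a b c t = diagMetric (fun α z => ![φ, a, b, c] α z t ^ 2) := by
  rw [metricAt, warpedMetric_eq_diagMetric]
  congr 1
  funext α
  fin_cases α <;> rfl

lemma pair_metricAt_frame (φ a b c : ℝ → ℝ → ℝ) (t : ℝ) (α : Fin 4) {p : Ambient}
    (hp : p ∈ cylinder) :
    pair (metricAt φ a b c t) (frame α) (frame α) p = ![φ, a, b, c] α p.1 t ^ 2 := by
  rw [metricAt_eq_diagMetric, frame_eq_comb, pair_comb _ _ _ (snd_ne_zero_of_mem_cylinder hp)]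
  simp [basisCoeff]

lemma IsWarpingFunction.log_smooth {f : ℝ → ℝ → ℝ} (hf : IsWarpingFunction T f) :
    SmoothUpTo T (fun z t => Real.log (f z t)) :=
  ContDiffOn.log hf.smooth fun x hx => (hf.pos x.1 x.2 hx.2).ne'

lemma curvature_metricAt (hX : ∀ α, IsWarpingFunction T (![φ, a, b, c] α)) {t : ℝ}
    (ht : t ∈ Set.Ico 0 T) {p : Ambient} (hp : p ∈ cylinder) :
    (∀ i : Fin 3, K (metricAt φ a b c t) 0 i.succ p =
      -(arcD φ (arcD φ (logWarp a b c i)) p.1 t + arcD φ (logWarp a b c i) p.1 t ^ 2)) ∧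
    ric (metricAt φ a b c t) (frame 0) (frame 0) p = -φ p.1 t ^ 2 *
      ∑ j, (arcD φ (arcD φ (logWarp a b c j)) p.1 t + arcD φ (logWarp a b c j) p.1 t ^ 2) ∧
    ∀ i : Fin 3, ric (metricAt φ a b c t) (frame i.succ) (frame i.succ) p =
      -![a, b, c] i p.1 t ^ 2 * (arcD φ (arcD φ (logWarp a b c i)) p.1 t
        + (∑ j, arcD φ (logWarp a b c j) p.1 t) * arcD φ (logWarp a b c i) p.1 t
        - 2 * fibreRic (quot (logWarp a b c) p.1 t) i) := by
  set X := ![φ, a, b, c] with hXdef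
  have hφ : IsWarpingFunction T φ := hX 0
  have hXs : ∀ i : Fin 3, X i.succ = ![a, b, c] i := fun i => rfl
  have hpos : ∀ α z, 0 < X α z t := fun α z => (hX α).pos z t ht
  set h : Fin 4 → ℝ → ℝ := fun α z => X α z t ^ 2 with hh
  set q : Fin 4 → ℝ → ℝ := fun α z => deriv (fun z => Real.log (X α z t)) z with hq
  set q' : Fin 4 → ℝ → ℝ := fun α z => deriv (q α) z with hq'
  have hlog : ∀ α, SmoothUpTo T (fun z t => Real.log (X α z t)) := fun α => (hX α).log_smooth
  have hXd : ∀ α z, HasDerivAt (fun z => X α z t) (q α z * X α z t) z := fun α z => by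
    have h1 := (((hlog α).contDiff ht).differentiable (by simp) z).hasDerivAt.exp
    rw [Real.exp_log (hpos α z), mul_comm] at h1
    exact h1.congr_of_eventuallyEq
      (Filter.Eventually.of_forall fun x => (Real.exp_log (hpos α x)).symm)
  have hhpos : ∀ α z, 0 < h α z := fun α z => pow_pos (hpos α z) 2
  have hhd : ∀ α z, HasDerivAt (h α) (2 * q α z * h α z) z := fun α z =>
    ((hXd α z).fun_pow 2).congr_deriv (by simp only [hh]; push_cast; ring)
  have hqd : ∀ α z, HasDerivAt (q α) (q' α z) z := fun α z =>
    (((hlog α).deriv_fst.contDiff ht).differentiable (by simp) z).hasDerivAt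
  have hl : ∀ i z, arcD φ (logWarp a b c i) z t = q i.succ z / φ z t := fun i z => rfl
  have hm : ∀ i z, arcD φ (arcD φ (logWarp a b c i)) z t =
      (q' i.succ z - q 0 z * q i.succ z) / φ z t ^ 2 := by
    intro i z
    have h0 := (hφ.pos z t ht).ne'
    refine arcD_eq_of_hasDerivAt (hφ.pos z t ht) ?_
    refine ((hqd i.succ z).fun_div (hXd 0 z) h0).congr_deriv ?_
    change (q' i.succ z * φ z t - q i.succ z * (q 0 z * φ z t)) / φ z t ^ 2 = _
    field_simp
  have hP : ∀ i z, quot (logWarp a b c) z t i =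
      X i.succ z t ^ 2 / (X 1 z t * X 2 z t * X 3 z t) := by
    intro i z
    rw [quot, Real.exp_sub, Fin.sum_univ_three, Real.exp_add, Real.exp_add,
      show ∀ x : ℝ, 2 * x = x + x from fun x => by ring, Real.exp_add]
    simp only [logWarp, ← hXs]
    rw [Real.exp_log (hpos _ z), Real.exp_log (hpos _ z), Real.exp_log (hpos _ z),
      Real.exp_log (hpos _ z), ← pow_two]
    rfl
  have hp' := snd_ne_zero_of_mem_cylinder hp
  have hφ0 : φ p.1 t ≠ 0 := (hφ.pos p.1 t ht).ne'
  have hh0 : h 0 p.1 = φ p.1 t ^ 2 := rfl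
  have hmetric : metricAt φ a b c t = diagMetric h := metricAt_eq_diagMetric φ a b c t
  refine ⟨fun i => ?_, ?_, fun i => ?_⟩
  · rw [hmetric, K_zero_succ hhpos hhd hqd i hp', hm, hl, hh0]
    field_simp
  · rw [hmetric, ric_zero hhpos hhd hqd hp']
    simp only [hm, hl]
    rw [Finset.mul_sum, ← Finset.sum_neg_distrib]
    refine Finset.sum_congr rfl fun j _ => ?_
    field_simp
  · rw [hmetric, ric_succ hhpos hhd hqd i hp']
    have e : fibreRic (quot (logWarp a b c) p.1 t) i =
        (h i.succ p.1 ^ 2 - (h (i + 1).succ p.1 - h (i + 2).succ p.1) ^ 2)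
          / (h 1 p.1 * h 2 p.1 * h 3 p.1) := by
      have h1 := (hpos 1 p.1).ne'
      have h2 := (hpos 2 p.1).ne'
      have h3 := (hpos 3 p.1).ne'
      simp only [fibreRic, hP, hh]
      field_simp
    rw [e]
    simp only [hm, hl, hh0]
    rw [← Finset.sum_div, show h i.succ p.1 = ![a, b, c] i p.1 t ^ 2 from rfl]
    field_simp
    ring

/-- The diagonal frame components of the flow at the points (z, 1) suffice, as the coefficients
depend on z alone. Half the logarithm of each component gives the equations for log φ and the y_i.
-/
theorem IsRicciFlow.logFlow (F : IsRicciFlow T φ a b c) : LogFlow T φ (logWarp a b c) := by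
  have hX : ∀ α, IsWarpingFunction T (![φ, a, b, c] α) := by
    intro α
    fin_cases α
    exacts [F.phi, F.fst, F.snd, F.thd]
  have hlog : ∀ α z, ∀ t ∈ Set.Ioo 0 T, HasDerivAt (fun τ => Real.log (![φ, a, b, c] α z τ))
      (-ric (metricAt φ a b c t) (frame α) (frame α) (z, 1) / ![φ, a, b, c] α z t ^ 2) t := by
    intro α z t ht
    have ht' := Set.Ioo_subset_Ico_self ht
    have hp : ((z, 1) : Ambient) ∈ cylinder := by simp [cylinder]
    have h1 := (F.flow t ht' (z, 1) hp α α).hasDerivAt (Ico_mem_nhds ht.1 ht.2)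
    simp only [pair_metricAt_frame φ a b c _ α hp] at h1
    have h2 := (h1.log (pow_pos ((hX α).pos z t ht') 2).ne').const_mul (1 / 2)
    refine (h2.congr_deriv (by ring)).congr_of_eventuallyEq
      (Filter.Eventually.of_forall fun τ => ?_)
    simp only [Real.log_pow]
    push_cast
    ring
  refine ⟨F.phi, fun i => (hX i.succ).log_smooth, fun i t ht z => ?_, fun z t ht => ?_,
    fun i z t ht => ?_⟩
  · exact congrArg Real.log ((hX i.succ).periodic t ht z)
  · have ht' := Set.Ioo_subset_Ico_self ht
    have h0 := F.phi.pos z t ht'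
    have h1 := (hlog 0 z t ht).exp
    rw [(curvature_metricAt hX ht' (p := (z, 1)) (by simp [cylinder])).2.1] at h1
    refine (h1.congr_of_eventuallyEq ?_).congr_deriv ?_
    · filter_upwards [Ioo_mem_nhds ht.1 ht.2] with τ hτ
      exact (Real.exp_log (F.phi.pos z τ (Set.Ioo_subset_Ico_self hτ))).symm
    · change Real.exp (Real.log (φ z t)) * (-(-φ z t ^ 2 * _) / φ z t ^ 2) = _
      rw [Real.exp_log h0]
      field_simp
  · have ht' := Set.Ioo_subset_Ico_self ht
    have h0 : 0 < ![a, b, c] i z t := (hX i.succ).pos z t ht'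
    have h1 := hlog i.succ z t ht
    rw [(curvature_metricAt hX ht' (p := (z, 1)) (by simp [cylinder])).2.2 i] at h1
    refine h1.congr_deriv ?_
    change -(-![a, b, c] i z t ^ 2 * _) / ![a, b, c] i z t ^ 2 = _
    field_simp

lemma minOverCircle_pos_and_le (ha : IsWarpingFunction T a) {t : ℝ} (ht : t ∈ Set.Ico 0 T) :
    0 < minOverCircle a t ∧ ∀ z, minOverCircle a t ≤ a z t := by
  have hcomp : IsCompact (Set.range fun z => a z t) :=
    (ha.periodic t ht).compact_of_continuous (by positivity)
      (SmoothUpTo.contDiff ha.smooth ht).continuous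
  constructor
  · obtain ⟨z, hz⟩ := hcomp.sInf_mem (Set.range_nonempty _)
    have : minOverCircle a t = a z t := hz.symm
    rw [this]
    exact ha.pos z t ht
  · exact fun z => ciInf_le hcomp.bddBelow z

end

end BianchiIX
end

/-! ### Choice of constants and conclusion. -/

open BianchiIX in
theorem mainTheorem5 (lam : ℝ) (hlam : lam < 2) (M : ℝ) :
    ∃ C : ℝ, 0 < C ∧
      ∀ (T : ℝ) (φ a b c : ℝ → ℝ → ℝ),
        BianchiIX.IsRicciFlow T φ a b c →
        BianchiIX.InitialBound M φ a b c →
        (∀ z, a z 0 ≤ b z 0 ∧ b z 0 ≤ c z 0) →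
        (∀ z, 1 ≤ c z 0 / a z 0 ∧ c z 0 / a z 0 ≤ lam) →
        ∀ t ∈ Set.Ico 0 T, ∀ p ∈ BianchiIX.cylinder,
          |BianchiIX.K (BianchiIX.metricAt φ a b c t) 0 1 p|
            + |BianchiIX.K (BianchiIX.metricAt φ a b c t) 0 2 p|
            + |BianchiIX.K (BianchiIX.metricAt φ a b c t) 0 3 p|
            ≤ C / BianchiIX.minOverCircle a t ^ 2 := by
  obtain ⟨κ, hκ0, hκ⟩ : ∃ κ : ℝ, 0 ≤ κ ∧ lam ≤ Real.exp κ :=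
    ⟨|lam|, abs_nonneg _, by linarith [le_abs_self lam, Real.add_one_le_exp |lam|]⟩
  obtain ⟨G, hG1, hGM, hG⟩ : ∃ G : ℝ, 1 ≤ G ∧ M < G ∧ 3 * Real.exp (2 * κ) ^ 3 ≤ G := by
    have h1 : 0 < Real.exp (2 * κ) ^ 3 := by positivity
    exact ⟨3 * Real.exp (2 * κ) ^ 3 + |M| + 1, by linarith [abs_nonneg M],
      by linarith [le_abs_self M], by linarith [abs_nonneg M]⟩
  -- Initially x_i² |m_i + l_i²| ≤ e^{2κ} M. For the sign -1 the quantity is -x_i² (m_i + l_i²) + 2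
  -- x_i² l_i², whence the extra 2G².
  obtain ⟨N, hN0, hNM, hN⟩ : ∃ N : ℝ, 0 < N ∧ Real.exp κ ^ 2 * M + 2 * G ^ 2 < N ∧
      700 * (Real.exp (2 * κ) * G) ^ 4 ≤ N := by
    have h1 : 0 ≤ (Real.exp (2 * κ) * G) ^ 4 := by positivity
    have h2 : 0 ≤ Real.exp κ ^ 2 * |M| := by positivity
    have h3 : Real.exp κ ^ 2 * M ≤ Real.exp κ ^ 2 * |M| :=
      mul_le_mul_of_nonneg_left (le_abs_self M) (by positivity)
    refine ⟨700 * (Real.exp (2 * κ) * G) ^ 4 + Real.exp κ ^ 2 * |M| + 2 * G ^ 2 + 1, ?_, ?_, ?_⟩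
      <;> nlinarith [sq_nonneg G]
  refine ⟨3 * (N * Real.exp κ ^ 2), by positivity, ?_⟩
  intro T φ a b c F hI hord hpinch t ht p hp
  have h0T : (0 : ℝ) ∈ Set.Ico 0 T := ⟨le_rfl, ht.1.trans_lt ht.2⟩
  have LF := F.logFlow
  have hX : ∀ α, IsWarpingFunction T (![φ, a, b, c] α) := by
    intro α
    fin_cases α
    exacts [F.phi, F.fst, F.snd, F.thd]
  have hpos : ∀ i z, ∀ t ∈ Set.Ico 0 T, 0 < ![a, b, c] i z t := fun i z t ht =>
    (hX i.succ).pos z t ht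
  have hexp : ∀ i z, ∀ t ∈ Set.Ico 0 T, Real.exp (logWarp a b c i z t) = ![a, b, c] i z t :=
    fun i z t ht => Real.exp_log (hpos i z t ht)
  have hexp2 : ∀ i z, ∀ t ∈ Set.Ico 0 T,
      Real.exp (2 * logWarp a b c i z t) = ![a, b, c] i z t ^ 2 := fun i z t ht => by
    rw [two_mul, Real.exp_add, hexp i z t ht, pow_two]
  have hy0 : ∀ i j z, logWarp a b c i z 0 - logWarp a b c j z 0 ≤ κ := by
    intro i j z
    have ha := F.fst.pos z 0 h0T
    have h1 : ∀ k, a z 0 ≤ ![a, b, c] k z 0 ∧ ![a, b, c] k z 0 ≤ c z 0 := by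
      have := hord z
      intro k
      fin_cases k
      exacts [⟨le_rfl, this.1.trans this.2⟩, this, ⟨this.1.trans this.2, le_rfl⟩]
    have h2 : c z 0 ≤ Real.exp κ * a z 0 :=
      (div_le_iff₀ ha).1 ((hpinch z).2.trans hκ)
    have h3 : logWarp a b c i z 0 ≤ Real.log (Real.exp κ * a z 0) :=
      Real.log_le_log (hpos i z 0 h0T) ((h1 i).2.trans h2)
    have h4 : Real.log (a z 0) ≤ logWarp a b c j z 0 := Real.log_le_log ha (h1 j).1
    rw [Real.log_mul (Real.exp_pos κ).ne' ha.ne', Real.log_exp] at h3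
    linarith
  have hy := LF.sub_le hy0
  have hcmp : ∀ i j z, ∀ t ∈ Set.Ico 0 T,
      ![a, b, c] i z t ^ 2 ≤ Real.exp κ ^ 2 * ![a, b, c] j z t ^ 2 := by
    intro i j z t ht
    rw [← mul_pow]
    refine pow_le_pow_left₀ (hpos i z t ht).le ?_ 2
    rw [← hexp i z t ht, ← hexp j z t ht, ← Real.exp_add, Real.exp_le_exp]
    linarith [hy i j t ht z]
  have hgrad0 : ∀ i z,
      |Real.exp (logWarp a b c i z 0) * arcD φ (logWarp a b c i) z 0| ≤ M := by
    intro i z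
    have e : Real.exp (logWarp a b c i z 0) * arcD φ (logWarp a b c i) z 0 =
        arcDeriv (fun z => φ z 0) (fun z => ![a, b, c] i z 0) z := by
      have h1 := (hpos i z 0 h0T).ne'
      have h2 : deriv (fun x => logWarp a b c i x 0) z =
          deriv (fun x => ![a, b, c] i x 0) z / ![a, b, c] i z 0 :=
        (((SmoothUpTo.contDiff (hX i.succ).smooth h0T).differentiable
          (by simp) z).hasDerivAt.log h1).deriv
      rw [hexp i z 0 h0T, arcD, arcDeriv, h2]
      field_simp
    rw [e]
    fin_cases i
    exacts [hI.fst z, hI.snd z, hI.thd z]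
  have hgrad := LF.abs_gradient_lt hκ0 hy hG fun i z => (hgrad0 i z).trans_lt hGM
  have hcurv0 : ∀ i z, ∀ s ∈ ({1, -1} : Set ℝ), Real.exp (2 * logWarp a b c i z 0) *
      (s * arcD φ (arcD φ (logWarp a b c i)) z 0 + arcD φ (logWarp a b c i) z 0 ^ 2) < N := by
    intro i z s hs
    have hcyl : ((z, 1) : Ambient) ∈ cylinder := by simp [cylinder]
    have h1 := hI.curv (z, 1) hcyl i
    rw [(curvature_metricAt hX h0T hcyl).1 i, abs_neg] at h1
    have h2 := hcmp i 0 z 0 h0T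
    have h3 := hgrad i 0 h0T z
    rw [hexp i z 0 h0T] at h3
    have h4 := sq_lt_sq' (abs_lt.1 h3).1 (abs_lt.1 h3).2
    rw [hexp2 i z 0 h0T]
    simp only [Matrix.cons_val_zero] at h1 h2
    generalize ![a, b, c] i z 0 = x at *
    generalize arcD φ (arcD φ (logWarp a b c i)) z 0 = m at *
    generalize arcD φ (logWarp a b c i) z 0 = l at *
    have h5 : x ^ 2 * |m + l ^ 2| ≤ Real.exp κ ^ 2 * M := by
      calc _ ≤ Real.exp κ ^ 2 * a z 0 ^ 2 * |m + l ^ 2| :=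
            mul_le_mul_of_nonneg_right h2 (abs_nonneg _)
        _ = Real.exp κ ^ 2 * (a z 0 ^ 2 * |m + l ^ 2|) := by ring
        _ ≤ _ := mul_le_mul_of_nonneg_left h1 (by positivity)
    have h6 := mul_le_mul_of_nonneg_left (le_abs_self (m + l ^ 2)) (sq_nonneg x)
    have h7 := mul_le_mul_of_nonneg_left (neg_abs_le (m + l ^ 2)) (sq_nonneg x)
    rcases hs with rfl | rfl <;> nlinarith [sq_nonneg G]
  have hcurv := LF.curvature_lt hκ0 hG1 hy (fun i t ht z => (hgrad i t ht z).le) hN hcurv0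
  obtain ⟨hmin0, hmin⟩ := minOverCircle_pos_and_le F.fst ht
  have hK : ∀ i : Fin 3, |K (metricAt φ a b c t) 0 i.succ p| ≤
      N * Real.exp κ ^ 2 / minOverCircle a t ^ 2 := by
    intro i
    rw [(curvature_metricAt hX ht hp).1 i, abs_neg]
    have h1 := hcurv i t ht p.1 1 (by simp)
    have h2 := hcurv i t ht p.1 (-1) (by simp)
    have h3 := hcmp 0 i p.1 t ht
    have h4 : minOverCircle a t ^ 2 ≤ a p.1 t ^ 2 := pow_le_pow_left₀ hmin0.le (hmin p.1) 2
    have hx := pow_pos (hpos i p.1 t ht) 2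
    rw [hexp2 i p.1 t ht] at h1 h2
    simp only [Matrix.cons_val_zero] at h3
    generalize ![a, b, c] i p.1 t = x at *
    generalize arcD φ (arcD φ (logWarp a b c i)) p.1 t = m at *
    generalize arcD φ (logWarp a b c i) p.1 t = l at *
    -- The sign 1 bounds m + l² from above; the sign -1 bounds -m + l², which dominates -(m + l²).
    have h5 : x ^ 2 * |m + l ^ 2| ≤ N := by
      have h6 : 0 ≤ x ^ 2 * l ^ 2 := by positivity
      rcases abs_cases (m + l ^ 2) with h | h <;> rw [h.1] <;> linarith
    rw [le_div_iff₀ (pow_pos hmin0 2)]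
    calc |m + l ^ 2| * minOverCircle a t ^ 2 ≤ |m + l ^ 2| * (Real.exp κ ^ 2 * x ^ 2) :=
          mul_le_mul_of_nonneg_left (h4.trans h3) (abs_nonneg _)
      _ = Real.exp κ ^ 2 * (x ^ 2 * |m + l ^ 2|) := by ring
      _ ≤ Real.exp κ ^ 2 * N := mul_le_mul_of_nonneg_left h5 (by positivity)
      _ = N * Real.exp κ ^ 2 := mul_comm _ _
  have k1 := hK 0
  have k2 := hK 1
  have k3 := hK 2
  rw [show 3 * (N * Real.exp κ ^ 2) / minOverCircle a t ^ 2 =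
    N * Real.exp κ ^ 2 / minOverCircle a t ^ 2 + N * Real.exp κ ^ 2 / minOverCircle a t ^ 2
      + N * Real.exp κ ^ 2 / minOverCircle a t ^ 2 by ring]
  exact add_le_add (add_le_add k1 k2) k3
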